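/- Let $n\ge 1$ and let $(S,g_S)$ be a compact Riemannian manifold of dimension $2n-1$. Write $t$ for the coordinate of $\mathbb R$ on the cylinder $\mathbb R\times S$, let $g_{\rm cyl}=dt^2+g_S$, and for a covariant tensor $\alpha$ on the cylinder put $\|\alpha\|_{C^k}=\sum_{i=0}^k\sup_{t\ge 0}|\nabla_{\rm cyl}^i\alpha|_{g_{\rm cyl}}$, where $\nabla_{\rm cyl}$ is the Levi-Civita connection of $g_{\rm cyl}$. Let $X$ be a complex manifold of complex dimension $n$ with cylindrical boundary: there are a compact set $K\subset X$ and a diffeomorphism $X\setminus K\cong\mathbb R\times S$ such that $K\cup\{t\le c\}$ is compact for every $c\in\mathbb R$; we identify $X\setminus K$ with the cylinder. A Riemannian metric $g$ on $X$ is called conical if $\|e^{\delta' t}(e^{-2t}g-g_{\rm cyl})\|_{C^{l}}<\infty$ for some $\delta'>0$ and some integer $l>4$. A Kähler form (a smooth closed positive real $(1,1)$-form) $\eta$ on $X$ is called conical if its Riemannian metric $\eta(\cdot,J\cdot)$ is conical, and Ricci-flat if its Ricci form $-\sqrt{-1}\,\partial\overline\partial\log\det(h_{j\bar k})$ vanishes,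 where $\eta=\frac{\sqrt{-1}}2\sum h_{j\bar k}\,dz_j\wedge d\bar z_k$ in holomorphic coordinates. **Theorem.** Let $\omega$ and $\omega'$ be two Ricci-flat conical Kähler forms on $X$ (with respect to the same $g_S$ and the same identification $X\setminus K\cong\mathbb R\times S$) such that $$\omega'=\omega+\sqrt{-1}\,\partial\overline\partial u$$ for a real function $u$ on $X$ of class $C^{\max(2,k)}$ with $\|e^{\delta t}u\|_{C^k}<\infty$, where $\delta>0$ is a real number and $k\ge 0$ an integer. Then $\omega=\omega'$. -/

import Mathlib

open scoped Manifold ContDiff Topology Bundle ENNReal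

noncomputable section

namespace ConicalKaehler

/-! ### Covariant tensor fields on a real manifold, read in a chart -/

section Tensors

variable {V : Type*} [NormedAddCommGroup V] [NormedSpace ℝ V]
  {H : Type*} [TopologicalSpace H] (I : ModelWithCorners ℝ V H)
  {N : Type*} [TopologicalSpace N] [ChartedSpace H N]

/-- The differential at `y` of the local parametrization of `N` that is inverse to the
preferred chart around `p₀`. -/
def chartFrame (p₀ : N) (y : V) : V →L[ℝ] TangentSpace I ((extChartAt I p₀).symm y) :=
  mfderiv 𝓘(ℝ, V) I (extChartAt I p₀).symm y

/-- A field of bilinear forms on `N`, written in the chart around `p₀`. -/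
def bilinInChart (g : ∀ p : N, TangentSpace I p →L[ℝ] TangentSpace I p →L[ℝ] ℝ)
    (p₀ : N) (y : V) : V →L[ℝ] V →L[ℝ] ℝ :=
  let b : V →L[ℝ] V →L[ℝ] ℝ := g ((extChartAt I p₀).symm y)
  let A : V →L[ℝ] V := chartFrame I p₀ y
  b.bilinearComp A A

/-- A covariant tensor field of rank `m` on `N`, written in the chart around `p₀`. -/
def tensorInChart {m : ℕ} (T : ∀ p : N, (Fin m → TangentSpace I p) → ℝ)
    (p₀ : N) (y : V) (v : Fin m → V) : ℝ :=
  T ((extChartAt I p₀).symm y) fun j => chartFrame I p₀ y (v j)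

/-- An alternating form of degree `m` on `N`, written in the chart around `p₀`. -/
def formInChart {m : ℕ} (η : ∀ p : N, (TangentSpace I p) [⋀^Fin m]→L[ℝ] ℝ)
    (p₀ : N) (y : V) : V [⋀^Fin m]→L[ℝ] ℝ :=
  (η ((extChartAt I p₀).symm y)).compContinuousLinearMap (chartFrame I p₀ y)

/-- The Christoffel symbols `Γ(v, w)` at `y` of the Levi-Civita connection of a metric `G`
on an open set of `V`:
`G (Γ(v, w), z) = (1/2) (∂_v G (w, z) + ∂_w G (v, z) - ∂_z G (v, w))` for all `z`. -/
def christoffel (G : V → V →L[ℝ] V →L[ℝ] ℝ) (y v w : V) : V :=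
  ContinuousLinearMap.inverse (G y)
    ((1 / 2 : ℝ) • (fderiv ℝ G y v w + fderiv ℝ G y w v - ((fderiv ℝ G y).flip v).flip w))

/-- The covariant derivative of a covariant tensor `T` with respect to the Levi-Civita
connection of `G`, the direction of differentiation being the new first argument:
`(∇T)(v₀, v₁, …, v_m) = ∂_{v₀} (T (v₁, …, v_m)) - ∑ⱼ T (v₁, …, Γ(v₀, vⱼ), …, v_m)`. -/
def covDeriv (G : V → V →L[ℝ] V →L[ℝ] ℝ) {m : ℕ} (T : V → (Fin m → V) → ℝ)
    (y : V) (v : Fin (m + 1) → V) : ℝ :=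
  fderiv ℝ (fun z => T z (Fin.tail v)) y (v 0) -
    ∑ j : Fin m, T y (Function.update (Fin.tail v) j (christoffel G y (v 0) (v j.succ)))

/-- The iterated covariant derivative `∇ⁱ T`. -/
def iterCovDeriv (G : V → V →L[ℝ] V →L[ℝ] ℝ) {m : ℕ} (T : V → (Fin m → V) → ℝ) :
    ∀ i : ℕ, V → (Fin (m + i) → V) → ℝ
  | 0 => T
  | i + 1 => covDeriv G (iterCovDeriv G T i)

/-- The pointwise norm of a covariant tensor with respect to an inner product `G`: the supremum
of `|T (v₁, …, v_m)|` over vectors with `G (vⱼ, vⱼ) ≤ 1`. -/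
def tensorNorm (G : V →L[ℝ] V →L[ℝ] ℝ) {m : ℕ} (T : (Fin m → V) → ℝ) : ℝ≥0∞ :=
  ⨆ (v : Fin m → V) (_ : ∀ j, G (v j) (v j) ≤ 1), ENNReal.ofReal |T v|

/-- `∑_{i ≤ k} sup_{p ∈ A} |∇ⁱ T|_g`, the `C^k`-norm over `A` of a covariant tensor field `T`
with respect to the Riemannian metric `g` and its Levi-Civita connection. -/
def ckNorm (g : ∀ p : N, TangentSpace I p →L[ℝ] TangentSpace I p →L[ℝ] ℝ) (A : Set N) (k : ℕ)
    {m : ℕ} (T : ∀ p : N, (Fin m → TangentSpace I p) → ℝ) : ℝ≥0∞ :=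
  ∑ i ∈ Finset.range (k + 1), ⨆ p ∈ A,
    tensorNorm (bilinInChart I g p (extChartAt I p p))
      (iterCovDeriv (bilinInChart I g p) (tensorInChart I T p) i (extChartAt I p p))

end Tensors

/-! ### Kähler forms -/

section Kaehler

/-- The model space `ℂⁿ` of complex manifolds of dimension `n`. -/
abbrev Cn (n : ℕ) : Type := EuclideanSpace ℂ (Fin n)

/-- The complex structure of `ℂⁿ`: multiplication by `i`. A tangent space of a complex manifold
is identified with `ℂⁿ` through a holomorphic chart, so this is also the complex structure of
each tangent space. -/
def cplxJ (n : ℕ) : Cn n →L[ℝ] Cn n :=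
  (Complex.I • ContinuousLinearMap.id ℂ (Cn n)).restrictScalars ℝ

/-- The complex structure of the tangent space at `x`. -/
def tangentJ {n : ℕ} {X : Type*} [TopologicalSpace X] [ChartedSpace (Cn n) X] (x : X) :
    TangentSpace 𝓘(ℝ, Cn n) x →L[ℝ] TangentSpace 𝓘(ℝ, Cn n) x :=
  cplxJ n

/-- The complex-valued form `∂̄f = (1/2) (df + i df ∘ J)` of a real function `f` on `ℂⁿ`. -/
def dbar {n : ℕ} (f : Cn n → ℝ) (y : Cn n) : Cn n [⋀^Fin 1]→L[ℝ] ℂ :=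
  ContinuousAlternatingMap.ofSubsingleton ℝ (Cn n) ℂ (0 : Fin 1)
    ((1 / 2 : ℂ) • (Complex.ofRealCLM.comp (fderiv ℝ f y) +
      Complex.I • Complex.ofRealCLM.comp ((fderiv ℝ f y).comp (cplxJ n))))

/-- The form `i ∂∂̄f` of a real function `f` on `ℂⁿ`, computed as `i d(∂̄f)` (since
`d = ∂ + ∂̄` and `∂̄∂̄ = 0`). -/
def iddbar {n : ℕ} (f : Cn n → ℝ) (y : Cn n) : Cn n [⋀^Fin 2]→L[ℝ] ℂ :=
  Complex.I • extDeriv (dbar f) y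

/-- Real `2`-forms on `X`. -/
abbrev TwoForm (n : ℕ) (X : Type*) [TopologicalSpace X] [ChartedSpace (Cn n) X] : Type _ :=
  ∀ x : X, (TangentSpace 𝓘(ℝ, Cn n) x) [⋀^Fin 2]→L[ℝ] ℝ

variable {n : ℕ} {X : Type*} [TopologicalSpace X] [ChartedSpace (Cn n) X]

/-- The bilinear form `g(v, w) = η(v, J w)`; for a Kähler form it is the associated
Riemannian metric. -/
def TwoForm.metric (η : TwoForm n X) (x : X) (v w : TangentSpace 𝓘(ℝ, Cn n) x) : ℝ :=
  η x ![v, tangentJ x w]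

/-- A Kähler form: a smooth closed real `2`-form of type `(1, 1)` (that is, invariant under `J`)
that is positive. -/
structure IsKaehlerForm (η : TwoForm n X) : Prop where
  smooth : ∀ x₀ : X, ContDiffOn ℝ ∞ (formInChart 𝓘(ℝ, Cn n) η x₀)
    (extChartAt 𝓘(ℝ, Cn n) x₀).target
  closed : ∀ x₀ : X, ∀ y ∈ (extChartAt 𝓘(ℝ, Cn n) x₀).target,
    extDeriv (formInChart 𝓘(ℝ, Cn n) η x₀) y = 0
  invariant : ∀ (x : X) (v w : TangentSpace 𝓘(ℝ, Cn n) x),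
    η x ![tangentJ x v, tangentJ x w] = η x ![v, w]
  pos : ∀ (x : X) (v : TangentSpace 𝓘(ℝ, Cn n) x), v ≠ 0 → 0 < η x ![v, tangentJ x v]

/-- The Hermitian matrix `h_{jk} = g(e_j, e_k) - i η(e_j, e_k)` of a `2`-form `η` on `ℂⁿ` with
`g = η(·, J ·)`, where `e_j` is the coordinate basis; thus `η = (i/2) ∑ h_{jk} dz_j ∧ dz̄_k` if
`η` is of type `(1, 1)`. -/
def hermMatrix (η : Cn n [⋀^Fin 2]→L[ℝ] ℝ) : Matrix (Fin n) (Fin n) ℂ :=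
  Matrix.of fun j k =>
    (η ![EuclideanSpace.single j 1, cplxJ n (EuclideanSpace.single k 1)] : ℂ) -
      Complex.I * (η ![EuclideanSpace.single j 1, EuclideanSpace.single k 1] : ℂ)

/-- The Ricci form `ρ = - i ∂∂̄ log det (h_{jk})` of a Kähler form `η`, in the holomorphic chart
around `x₀` (the determinant of a positive definite Hermitian matrix is a positive real). -/
def ricciForm (η : TwoForm n X) (x₀ : X) (y : Cn n) : Cn n [⋀^Fin 2]→L[ℝ] ℂ :=
  -iddbar (fun z => Real.log (hermMatrix (formInChart 𝓘(ℝ, Cn n) η x₀ z)).det.re) y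

/-- The Ricci curvature of the Kähler form `η` vanishes. -/
def IsRicciFlat (η : TwoForm n X) : Prop :=
  ∀ x₀ : X, ∀ y ∈ (extChartAt 𝓘(ℝ, Cn n) x₀).target, ricciForm η x₀ y = 0

/-- `η' = η + i ∂∂̄u` on `X`. -/
def EqAddIddbar (η' η : TwoForm n X) (u : X → ℝ) : Prop :=
  ∀ x₀ : X, ∀ y ∈ (extChartAt 𝓘(ℝ, Cn n) x₀).target, ∀ v : Fin 2 → Cn n,
    (formInChart 𝓘(ℝ, Cn n) η' x₀ y v : ℂ) =
      (formInChart 𝓘(ℝ, Cn n) η x₀ y v : ℂ) +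
        iddbar (fun z => u ((extChartAt 𝓘(ℝ, Cn n) x₀).symm z)) y v

end Kaehler

/-! ### Cylindrical boundary and conical metrics -/

section Conical

/-- The model space of the link `S`, of real dimension `2n - 1`. -/
abbrev LinkModel (n : ℕ) : Type := EuclideanSpace ℝ (Fin (2 * n - 1))

/-- The model with corners of the cylinder `ℝ × S`. -/
abbrev cylModel (n : ℕ) :
    ModelWithCorners ℝ (ℝ × LinkModel n) (ModelProd ℝ (LinkModel n)) :=
  𝓘(ℝ, ℝ).prod 𝓘(ℝ, LinkModel n)

variable {n : ℕ} {S : Type*} [TopologicalSpace S] [ChartedSpace (LinkModel n) S]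

/-- The product metric `g_cyl = dt² + g_S` on `ℝ × S`. -/
def cylMetric [IsManifold 𝓘(ℝ, LinkModel n) ∞ S]
    (gS : Bundle.ContMDiffRiemannianMetric 𝓘(ℝ, LinkModel n) ∞ (LinkModel n)
      (TangentSpace 𝓘(ℝ, LinkModel n) : S → Type _)) (p : ℝ × S) :
    TangentSpace (cylModel n) p →L[ℝ] TangentSpace (cylModel n) p →L[ℝ] ℝ :=
  let dt : ℝ × LinkModel n →L[ℝ] ℝ := mfderiv (cylModel n) 𝓘(ℝ, ℝ) (Prod.fst : ℝ × S → ℝ) p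
  let dπ : ℝ × LinkModel n →L[ℝ] LinkModel n :=
    mfderiv (cylModel n) 𝓘(ℝ, LinkModel n) (Prod.snd : ℝ × S → S) p
  let b : LinkModel n →L[ℝ] LinkModel n →L[ℝ] ℝ := gS.inner p.2
  dt.smulRight dt + b.bilinearComp dπ dπ

/-- The half `t ≥ 0` of the cylinder `ℝ × S`. -/
def halfCyl (S : Type*) : Set (ℝ × S) := {p | 0 ≤ p.1}

/-- A cylindrical boundary `ℝ × S` of `X`: a compact set `K` and a diffeomorphism of `X \ K` with
`ℝ × S` such that the sets `K ∪ {t ≤ c}` are compact, that is, only the end `t → +∞` of the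
cylinder goes to infinity in `X`. -/
structure CylindricalBoundary (n : ℕ) (X : Type*) [TopologicalSpace X] [ChartedSpace (Cn n) X]
    (S : Type*) [TopologicalSpace S] [ChartedSpace (LinkModel n) S] where
  /-- the compact part -/
  K : Set X
  /-- the identification of the complement of `K` with the cylinder -/
  Φ : OpenPartialHomeomorph X (ℝ × S)
  source_eq : Φ.source = Kᶜ
  target_eq : Φ.target = Set.univ
  smooth : ContMDiffOn 𝓘(ℝ, Cn n) (cylModel n) ∞ Φ Kᶜ
  smooth_symm : ContMDiff (cylModel n) 𝓘(ℝ, Cn n) ∞ Φ.symm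
  isCompact_K : IsCompact K
  isCompact_sublevel : ∀ c : ℝ, IsCompact (K ∪ {x | x ∈ Kᶜ ∧ (Φ x).1 ≤ c})

variable {X : Type*} [TopologicalSpace X] [ChartedSpace (Cn n) X]

/-- A metric on `X`, pulled back to the cylinder. -/
def CylindricalBoundary.pullback (B : CylindricalBoundary n X S)
    (g : ∀ x : X, TangentSpace 𝓘(ℝ, Cn n) x → TangentSpace 𝓘(ℝ, Cn n) x → ℝ)
    (p : ℝ × S) (v w : TangentSpace (cylModel n) p) : ℝ :=
  g (B.Φ.symm p) (mfderiv (cylModel n) 𝓘(ℝ, Cn n) B.Φ.symm p v)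
    (mfderiv (cylModel n) 𝓘(ℝ, Cn n) B.Φ.symm p w)

variable [IsManifold 𝓘(ℝ, LinkModel n) ∞ S]

/-- A metric `h` on the end is cylindrical: `‖e^{δt} (h - g_cyl)‖_{C^k} < ∞` for some `δ > 0` and
some integer `k > 4`. -/
def IsCylindrical
    (gS : Bundle.ContMDiffRiemannianMetric 𝓘(ℝ, LinkModel n) ∞ (LinkModel n)
      (TangentSpace 𝓘(ℝ, LinkModel n) : S → Type _))
    (h : ∀ p : ℝ × S, TangentSpace (cylModel n) p → TangentSpace (cylModel n) p → ℝ) : Prop :=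
  ∃ δ : ℝ, 0 < δ ∧ ∃ k : ℕ, 4 < k ∧
    ckNorm (cylModel n) (cylMetric gS) (halfCyl S) k (m := 2)
      (fun p v => Real.exp (δ * p.1) * (h p (v 0) (v 1) - cylMetric gS p (v 0) (v 1))) < ⊤

/-- A metric `g` on `X` is conical if `e^{-2t} g` is cylindrical. -/
def IsConical (B : CylindricalBoundary n X S)
    (gS : Bundle.ContMDiffRiemannianMetric 𝓘(ℝ, LinkModel n) ∞ (LinkModel n)
      (TangentSpace 𝓘(ℝ, LinkModel n) : S → Type _))
    (g : ∀ x : X, TangentSpace 𝓘(ℝ, Cn n) x → TangentSpace 𝓘(ℝ, Cn n) x → ℝ) : Prop :=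
  IsCylindrical gS fun p v w => Real.exp (-2 * p.1) * B.pullback g p v w

/-- A Ricci-flat conical Kähler metric, given by its Kähler form. -/
structure IsRicciFlatConicalKaehler (B : CylindricalBoundary n X S)
    (gS : Bundle.ContMDiffRiemannianMetric 𝓘(ℝ, LinkModel n) ∞ (LinkModel n)
      (TangentSpace 𝓘(ℝ, LinkModel n) : S → Type _)) (η : TwoForm n X) : Prop where
  kaehler : IsKaehlerForm η
  conical : IsConical B gS η.metric
  ricciFlat : IsRicciFlat η

/-- The weighted norm `‖e^{δt} u‖_{C^k}` of a function `u` on `X` along the end. -/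
def weightedCkNorm (B : CylindricalBoundary n X S)
    (gS : Bundle.ContMDiffRiemannianMetric 𝓘(ℝ, LinkModel n) ∞ (LinkModel n)
      (TangentSpace 𝓘(ℝ, LinkModel n) : S → Type _)) (δ : ℝ) (k : ℕ) (u : X → ℝ) : ℝ≥0∞ :=
  ckNorm (cylModel n) (cylMetric gS) (halfCyl S) k (m := 0)
    (fun p _ => Real.exp (δ * p.1) * u (B.Φ.symm p))

end Conical

end ConicalKaehler

end

/-!
Let `ω₂ = ω₁ + i∂∂̄u`. The proof applies the maximum principle twice, to functions that tend to zero
at infinity.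

The first function is `f = log (det h₂ / det h₁)`, the logarithm of the quotient of the two volume
forms (`logDetRatio`). It does not depend on the chart, it is pluriharmonic because both forms are
Ricci-flat, and it tends to zero along the end because both metrics are asymptotic to
`e^{2t} g_cyl` (`exists_logDetRatio_lt`). Pluriharmonic functions satisfy the strong maximum and
minimum principles, so `f` is constant on every connected component of `X`
(`eq_of_mem_connectedComponent`), and a nonzero constant is possible on a compact component only.
There `u` has a maximum, at which `i∂∂̄u ≤ 0` and so `f ≤ 0`, and a minimum, at which `f ≥ 0`. Hence
`f = 0` (`logDetRatio_eq_zero`).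

The second function is `u`. At a point, choose a basis of the tangent space that is unitary for `ω₁`
and diagonalizes `ω₂`, with eigenvalues `λᵢ` (`exists_adapted_frame`). Since `∏ λᵢ = 1`, the
Laplacian `∑ (λᵢ - 1)` of `u` with respect to `ω₁` is nonnegative. So `u` satisfies the strong
maximum principle, and by symmetry so does `-u`. As `u` tends to zero at infinity, it is constant on
components, and `i∂∂̄u = 0`.

The strong maximum principle needed here (`eventually_eq_of_isMaxOn_of_elliptic`) is Hopf's, for a
second order operator without lower order terms. The operator is given at each point by a finite
family of vectors `eᵢ` as `∑ D²u(eᵢ, eᵢ)`, with uniform bounds but no regularity in the point.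
-/

noncomputable section

namespace ConicalKaehler

/-! ### The strong maximum principle in a Euclidean space -/

section MaximumPrinciple

theorem fderiv_fderiv_apply_self_nonpos_of_isLocalMax {E : Type*} [NormedAddCommGroup E]
    [NormedSpace ℝ E] {u : E → ℝ} {z : E} (hu : ContDiffAt ℝ 2 u z) (hz : IsLocalMax u z) (e : E) :
    fderiv ℝ (fderiv ℝ u) z e e ≤ 0 := by
  by_contra! hpos
  -- on the line through `z` along `e`, the point `z` is then also a local minimum of `u`, so that
  -- `u` is constant near `z` on that line
  set γ : ℝ → E := fun s => z + s • e with hγ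
  have hγ0 : γ 0 = z := by simp [hγ]
  have hγd (s : ℝ) : HasDerivAt γ e s := by
    simpa [hγ] using ((hasDerivAt_id s).smul_const e).const_add z
  have hγc : Filter.Tendsto γ (𝓝 0) (𝓝 z) := by
    have := (hγd 0).continuousAt.tendsto
    rwa [hγ0] at this
  have h1 : ∀ᶠ s in 𝓝 (0 : ℝ), deriv (u ∘ γ) s = fderiv ℝ u (γ s) e := by
    have : ∀ᶠ x in 𝓝 z, DifferentiableAt ℝ u x :=
      (hu.eventually (by simp)).mono fun x hx => hx.differentiableAt (by simp)
    filter_upwards [hγc.eventually this] with s hs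
    exact (hs.hasFDerivAt.comp_hasDerivAt s (hγd s)).deriv
  have h2 : HasDerivAt (fun s => fderiv ℝ u (γ s) e) (fderiv ℝ (fderiv ℝ u) z e e) 0 := by
    have hd : DifferentiableAt ℝ (fderiv ℝ u) z :=
      (hu.fderiv_right (m := 1) (by norm_num)).differentiableAt (by simp)
    have h := (hγ0 ▸ hd.hasFDerivAt : HasFDerivAt (fderiv ℝ u) (fderiv ℝ (fderiv ℝ u) z) (γ 0))
    have := (h.comp_hasDerivAt 0 (hγd 0)).clm_apply (hasDerivAt_const (0 : ℝ) e)
    simpa using this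
  have h3 : deriv (deriv (u ∘ γ)) 0 = fderiv ℝ (fderiv ℝ u) z e e := by
    rw [Filter.EventuallyEq.deriv_eq h1, h2.deriv]
  have hmax : IsLocalMax (u ∘ γ) 0 := by
    have h0 : IsLocalMax u (γ 0) := by rwa [hγ0]
    exact h0.comp_continuous (g := γ) (hγd 0).continuousAt
  have hcont : ContinuousAt (u ∘ γ) 0 := by
    refine ContinuousAt.comp ?_ (hγd 0).continuousAt
    rw [hγ0]; exact hu.continuousAt
  have hmin := isLocalMin_of_deriv_deriv_pos (h3 ▸ hpos) hmax.deriv_eq_zero hcont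
  have hconst : ∀ᶠ s in 𝓝 (0 : ℝ), (u ∘ γ) s = (u ∘ γ) 0 := by
    filter_upwards [hmax, hmin] with s h h'
    exact le_antisymm h h'
  have h4 : ∀ᶠ s in 𝓝 (0 : ℝ), deriv (u ∘ γ) s = 0 := by
    filter_upwards [hconst.eventually_nhds] with s hs
    rw [Filter.EventuallyEq.deriv_eq (f := fun _ => (u ∘ γ) 0) hs, deriv_const]
  rw [Filter.EventuallyEq.deriv_eq (f := fun _ => (0 : ℝ)) h4, deriv_const] at h3
  exact hpos.ne h3

variable {E : Type*} [NormedAddCommGroup E] [InnerProductSpace ℝ E]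

/-- The Gaussian `exp (-α ‖x - y‖²)`, the comparison function in Hopf's argument. -/
def gaussianBump (α : ℝ) (y x : E) : ℝ := Real.exp (-α * ‖x - y‖ ^ 2)

theorem contDiff_gaussianBump (α : ℝ) (y : E) : ContDiff ℝ ∞ (gaussianBump α y) := by
  unfold gaussianBump
  exact Real.contDiff_exp.comp (contDiff_const.mul ((contDiff_id.sub contDiff_const).norm_sq ℝ))

theorem fderiv_fderiv_gaussianBump (α : ℝ) (y x e : E) :
    fderiv ℝ (fderiv ℝ (gaussianBump α y)) x e e =
      gaussianBump α y x * (4 * α ^ 2 * inner ℝ (x - y) e ^ 2 - 2 * α * ‖e‖ ^ 2) := by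
  have hs (x : E) : HasFDerivAt (fun x : E => ‖x - y‖ ^ 2) (2 • innerSL ℝ (x - y)) x := by
    have := ((hasFDerivAt_id x).sub_const y).norm_sq
    simpa using this
  have h1 (x : E) : HasFDerivAt (gaussianBump α y)
      (gaussianBump α y x • ((-α) • (2 • innerSL ℝ (x - y)))) x :=
    ((hs x).const_mul (-α)).exp
  have h2 : (fun x => fderiv ℝ (gaussianBump α y) x e) =
      fun x => gaussianBump α y x * (-2 * α * inner ℝ (x - y) e) := by
    funext x
    rw [(h1 x).fderiv]
    simp only [smul_apply, innerSL_apply_apply, smul_eq_mul, nsmul_eq_mul]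
    push_cast
    ring
  have hd : DifferentiableAt ℝ (fderiv ℝ (gaussianBump α y)) x :=
    ((contDiff_gaussianBump α y).fderiv_right (m := 1) (by norm_cast)).contDiffAt.differentiableAt
      (by simp)
  have h3 : fderiv ℝ (fun x => fderiv ℝ (gaussianBump α y) x e) x e =
      fderiv ℝ (fderiv ℝ (gaussianBump α y)) x e e := by
    rw [fderiv_clm_apply hd (differentiableAt_const e)]
    simp
  rw [← h3, h2]
  have hi : HasFDerivAt (fun x : E => inner ℝ (x - y) e) (innerSL ℝ e) x := by
    have := (innerSL ℝ e).hasFDerivAt.comp x ((hasFDerivAt_id x).sub_const y)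
    simpa [Function.comp_def, real_inner_comm] using this
  rw [((h1 x).fun_mul (hi.const_mul (-2 * α))).fderiv]
  simp only [add_apply, smul_apply, innerSL_apply_apply,
    smul_eq_mul, nsmul_eq_mul, real_inner_self_eq_norm_sq]
  push_cast
  ring

/-- Far from its centre, a steep Gaussian is a strict subsolution of a uniformly elliptic operator:
the term of order `α²` in its second derivatives dominates. -/
theorem sum_fderiv_fderiv_gaussianBump_pos {ι : Type*} [Fintype ι] {α c C R : ℝ} (hα : 0 < α)
    (hR : 0 < R) (hc : 0 < c) (hαR : Fintype.card ι * C ^ 2 < 2 * α * c * R ^ 2)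
    {x y : E} (hxy : R ≤ ‖x - y‖) {e : ι → E} (he : ∀ i, ‖e i‖ ≤ C)
    (hell : ∀ ξ : E, c * ‖ξ‖ ^ 2 ≤ ∑ i, inner ℝ ξ (e i) ^ 2) :
    0 < ∑ i, fderiv ℝ (fderiv ℝ (gaussianBump α y)) x (e i) (e i) := by
  simp only [fderiv_fderiv_gaussianBump, ← Finset.mul_sum, Finset.sum_sub_distrib]
  refine mul_pos (Real.exp_pos _) ?_
  have h1 : ∑ i, ‖e i‖ ^ 2 ≤ Fintype.card ι * C ^ 2 := by
    have := Finset.sum_le_card_nsmul Finset.univ (fun i => ‖e i‖ ^ 2) (C ^ 2)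
      fun i _ => pow_le_pow_left₀ (norm_nonneg _) (he i) 2
    simpa using this
  have h2 : c * R ^ 2 ≤ ∑ i, inner ℝ (x - y) (e i) ^ 2 :=
    le_trans (by gcongr) (hell (x - y))
  have h3 : α ^ 2 * (c * R ^ 2) ≤ α ^ 2 * ∑ i, inner ℝ (x - y) (e i) ^ 2 := by gcongr
  have h4 : α * ∑ i, ‖e i‖ ^ 2 ≤ α * (Fintype.card ι * C ^ 2) := by gcongr
  have h5 : α * (Fintype.card ι * C ^ 2) < α * (2 * α * c * R ^ 2) := by gcongr
  nlinarith

/-- Hopf's strong maximum principle, local form. The family `e` at `z` stands for the operator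
`u ↦ ∑ D²u(eᵢ, eᵢ)`, with ellipticity constant `c` and coefficients bounded by `C`. -/
theorem eventually_eq_of_isMaxOn_of_elliptic [FiniteDimensional ℝ E] {ι : Type*} [Fintype ι]
    {u : E → ℝ} {p : E} {U : Set E} (hU : IsOpen U) (hpU : p ∈ U) (hu : ContDiffOn ℝ 2 u U)
    {c C : ℝ} (hc : 0 < c)
    (hell : ∀ z ∈ U, ∃ e : ι → E, (∀ i, ‖e i‖ ≤ C) ∧
      (∀ ξ : E, c * ‖ξ‖ ^ 2 ≤ ∑ i, inner ℝ ξ (e i) ^ 2) ∧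
      0 ≤ ∑ i, fderiv ℝ (fderiv ℝ u) z (e i) (e i))
    (hmax : ∀ z ∈ U, u z ≤ u p) : ∀ᶠ z in 𝓝 p, u z = u p := by
  obtain ⟨ρ, hρ, hρU⟩ := Metric.nhds_basis_closedBall.mem_iff.1 (hU.mem_nhds hpU)
  have hcont : ContinuousOn u U := hu.continuousOn
  filter_upwards [Metric.ball_mem_nhds p (half_pos hρ)] with y hy
  by_contra hne
  have hyU : y ∈ U := hρU (Metric.mem_closedBall.2 (by rw [Metric.mem_ball] at hy; linarith))
  -- a point `x₀` of the maximum set that is closest to `y`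
  set M : Set E := {z ∈ Metric.closedBall p ρ | u z = u p} with hM
  have hMc : IsCompact M := by
    have : M = Metric.closedBall p ρ ∩ u ⁻¹' {u p} := rfl
    rw [this]
    exact (isCompact_closedBall p ρ).of_isClosed_subset
      ((hcont.mono hρU).preimage_isClosed_of_isClosed Metric.isClosed_closedBall isClosed_singleton)
      Set.inter_subset_left
  have hpM : p ∈ M := ⟨Metric.mem_closedBall_self hρ.le, rfl⟩
  obtain ⟨x₀, hx₀M, hx₀⟩ := hMc.exists_infDist_eq_dist ⟨p, hpM⟩ y
  set R := dist y x₀ with hRdef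
  have hRpos : 0 < R := dist_pos.2 fun h => hne (h ▸ hx₀M.2)
  have hRle : R ≤ dist y p := hx₀ ▸ Metric.infDist_le_dist_of_mem hpM
  rw [Metric.mem_ball] at hy
  have hx₀ρ : dist x₀ p < ρ := by
    have := dist_triangle x₀ y p
    rw [dist_comm x₀ y] at this
    linarith
  have hball : ∀ z, dist z y < R → u z < u p := by
    intro z hz
    have hzρ : z ∈ Metric.closedBall p ρ := by
      have := dist_triangle z y p
      rw [Metric.mem_closedBall]; linarith
    refine lt_of_le_of_ne (hmax z (hρU hzρ)) fun h => ?_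
    have : R ≤ dist y z := hx₀ ▸ Metric.infDist_le_dist_of_mem (s := M) ⟨hzρ, h⟩
    rw [dist_comm] at this
    linarith
  -- the ball of radius `R / 2` around the midpoint touches the maximum set only at `x₀`
  set w : E := y + (1 / 2 : ℝ) • (x₀ - y) with hw
  have hwx : x₀ - w = (1 / 2 : ℝ) • (x₀ - y) := by
    rw [hw]; module
  have hwy : w - y = (1 / 2 : ℝ) • (x₀ - y) := by
    rw [hw]; module
  have hnorm : ‖(1 / 2 : ℝ) • (x₀ - y)‖ = R / 2 := by
    rw [norm_smul, hRdef, dist_comm, dist_eq_norm]; norm_num; ring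
  have hsmall : ∀ z, ‖z - w‖ ≤ R / 2 → z ≠ x₀ → u z < u p := by
    intro z hz hzx
    refine hball z ?_
    -- strict convexity of the norm
    have hpar := parallelogram_law_with_norm ℝ (z - w) (w - y)
    have h1 : z - w + (w - y) = z - y := by abel
    have h2 : z - w - (w - y) = z - x₀ := by rw [hwy, ← hwx]; abel
    rw [h1, h2, hwy, hnorm] at hpar
    have h3 : 0 < ‖z - x₀‖ := norm_pos_iff.2 (sub_ne_zero.2 hzx)
    rw [dist_eq_norm]
    have h4 := norm_nonneg (z - w)
    nlinarith [norm_nonneg (z - y)]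
  -- a small ball around `x₀`
  set r := min (R / 4) ((ρ - dist x₀ p) / 2) with hr
  have hrpos : 0 < r := lt_min (by linarith) (by linarith)
  have hrR : r ≤ R / 4 := min_le_left _ _
  have hsub : Metric.closedBall x₀ r ⊆ U := by
    intro z hz
    refine hρU ?_
    rw [Metric.mem_closedBall] at hz ⊢
    have h1 := dist_triangle z x₀ p
    have h2 : r ≤ (ρ - dist x₀ p) / 2 := min_le_right _ _
    linarith
  have hfar : ∀ z ∈ Metric.closedBall x₀ r, R / 4 ≤ ‖z - w‖ := by
    intro z hz
    rw [Metric.mem_closedBall, dist_eq_norm] at hz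
    have h1 : x₀ - w = (z - w) - (z - x₀) := by abel
    have h2 := norm_sub_le (z - w) (z - x₀)
    rw [← h1, hwx, hnorm] at h2
    linarith
  obtain ⟨α, hα, hαR⟩ : ∃ α : ℝ, 0 < α ∧ Fintype.card ι * C ^ 2 < 2 * α * c * (R / 4) ^ 2 := by
    have hk : 0 < 2 * c * (R / 4) ^ 2 := by positivity
    refine ⟨(Fintype.card ι * C ^ 2 + 1) / (2 * c * (R / 4) ^ 2), by positivity, ?_⟩
    have : 2 * ((Fintype.card ι * C ^ 2 + 1) / (2 * c * (R / 4) ^ 2)) * c * (R / 4) ^ 2 =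
        Fintype.card ι * C ^ 2 + 1 := by field_simp
    rw [this]; linarith
  set v : E → ℝ := gaussianBump α w with hv
  have hvc : ContDiff ℝ ∞ v := contDiff_gaussianBump α w
  -- on the part of the small sphere inside the touching ball, `u` stays below its maximum
  obtain ⟨ε, hε, hεv⟩ : ∃ ε : ℝ, 0 < ε ∧ ∀ z ∈ Metric.sphere x₀ r, ‖z - w‖ ≤ R / 2 →
      u z + ε * v z ≤ u p := by
    set Q : Set E := Metric.sphere x₀ r ∩ Metric.closedBall w (R / 2) with hQ
    have hQc : IsCompact Q := (isCompact_sphere x₀ r).inter_right Metric.isClosed_closedBall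
    rcases Q.eq_empty_or_nonempty with hQe | hQn
    · refine ⟨1, one_pos, fun z hz hz' => ?_⟩
      have : z ∈ Q := ⟨hz, by rwa [Metric.mem_closedBall, dist_eq_norm]⟩
      rw [hQe] at this
      exact this.elim
    · obtain ⟨q, hqQ, hq⟩ := hQc.exists_isMaxOn hQn
        (hcont.mono fun z hz => hsub (Metric.sphere_subset_closedBall hz.1))
      have hqlt : u q < u p := by
        refine hsmall q (by simpa [dist_eq_norm] using hqQ.2) ?_
        rintro rfl
        have := hqQ.1
        simp only [Metric.mem_sphere, dist_self] at this
        linarith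
      refine ⟨u p - u q, by linarith, fun z hz hz' => ?_⟩
      have h1 : u z ≤ u q := hq (show z ∈ Q from ⟨hz, by rwa [Metric.mem_closedBall, dist_eq_norm]⟩)
      have h2 : v z ≤ 1 := by
        rw [hv, gaussianBump, Real.exp_le_one_iff]
        nlinarith [sq_nonneg ‖z - w‖]
      nlinarith
  -- the perturbed function has an interior maximum, where its second derivatives are too big
  set f : E → ℝ := fun z => u z + ε * v z with hf
  have hfc : ContDiffOn ℝ 2 f U :=
    hu.add (contDiffOn_const.mul (hvc.of_le (by norm_cast)).contDiffOn)
  have hfx₀ : f x₀ = u p + ε * v x₀ := by rw [hf]; simp [hx₀M.2]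
  have hsphere : ∀ z ∈ Metric.sphere x₀ r, f z ≤ f x₀ := by
    intro z hz
    rw [hfx₀]
    have hvpos : 0 < v x₀ := Real.exp_pos _
    by_cases h : ‖z - w‖ ≤ R / 2
    · have := hεv z hz h
      simp only [hf]; nlinarith
    · have h1 : v z ≤ v x₀ := by
        simp only [hv, gaussianBump, hwx, hnorm]
        refine Real.exp_le_exp.2 ?_
        have h2 : (R / 2) ^ 2 ≤ ‖z - w‖ ^ 2 := by
          push Not at h
          exact pow_le_pow_left₀ (by linarith) h.le 2
        nlinarith
      have h2 := hmax z (hsub (Metric.sphere_subset_closedBall hz))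
      simp only [hf]; nlinarith
  obtain ⟨q, hqb, hq⟩ : ∃ q ∈ Metric.ball x₀ r, ∀ z ∈ Metric.closedBall x₀ r, f z ≤ f q := by
    obtain ⟨q, hq, hqm⟩ := (isCompact_closedBall x₀ r).exists_isMaxOn
      ⟨x₀, Metric.mem_closedBall_self hrpos.le⟩ (hfc.continuousOn.mono hsub)
    rcases (Metric.mem_closedBall.1 hq).lt_or_eq with h | h
    · exact ⟨q, h, fun z hz => hqm hz⟩
    · exact ⟨x₀, Metric.mem_ball_self hrpos, fun z hz => (hqm hz).trans (hsphere q h)⟩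
  have hqU : q ∈ U := hsub (Metric.ball_subset_closedBall hqb)
  have hlm : IsLocalMax f q := by
    filter_upwards [Metric.isOpen_ball.mem_nhds hqb] with z hz
    exact hq z (Metric.ball_subset_closedBall hz)
  obtain ⟨e, heC, hec, hesum⟩ := hell q hqU
  have hpos := sum_fderiv_fderiv_gaussianBump_pos hα (by linarith : 0 < R / 4) hc hαR
    (hfar q (Metric.ball_subset_closedBall hqb)) heC hec
  have hUq : U ∈ 𝓝 q := hU.mem_nhds hqU
  have hsum : ∀ i, fderiv ℝ (fderiv ℝ f) q (e i) (e i) =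
      fderiv ℝ (fderiv ℝ u) q (e i) (e i) + ε * fderiv ℝ (fderiv ℝ v) q (e i) (e i) := by
    intro i
    have h1 : fderiv ℝ f =ᶠ[𝓝 q] fun z => fderiv ℝ u z + ε • fderiv ℝ v z := by
      filter_upwards [hUq] with z hz
      have hud : DifferentiableAt ℝ u z :=
        (hu.contDiffAt (hU.mem_nhds hz)).differentiableAt (by simp)
      have hvd : DifferentiableAt ℝ v z := hvc.contDiffAt.differentiableAt (by simp)
      rw [hf, fderiv_fun_add hud (hvd.const_mul ε), fderiv_const_mul hvd]
    have hud : DifferentiableAt ℝ (fderiv ℝ u) q :=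
      ((hu.contDiffAt hUq).fderiv_right (m := 1) (by norm_num)).differentiableAt (by simp)
    have hvd : DifferentiableAt ℝ (fderiv ℝ v) q :=
      (hvc.contDiffAt.fderiv_right (m := 1) (by norm_cast)).differentiableAt (by simp)
    rw [h1.fderiv_eq, fderiv_fun_add hud (hvd.fun_const_smul ε), fderiv_fun_const_smul hvd]
    simp
  have hle : ∑ i, fderiv ℝ (fderiv ℝ f) q (e i) (e i) ≤ 0 :=
    Finset.sum_nonpos fun i _ =>
      fderiv_fderiv_apply_self_nonpos_of_isLocalMax (hfc.contDiffAt hUq) hlm (e i)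
  simp only [hsum, Finset.sum_add_distrib, ← Finset.mul_sum] at hle
  nlinarith [mul_pos hε hpos]

end MaximumPrinciple

/-! ### Positive (1, 1)-forms and Hermitian matrices -/

section Hermitian

open scoped ComplexOrder

variable {n : ℕ}

theorem cplxJ_apply (v : Cn n) : cplxJ n v = Complex.I • v := rfl

theorem cplxJ_cplxJ (v : Cn n) : cplxJ n (cplxJ n v) = -v := by
  simp [cplxJ_apply, smul_smul]

theorem complex_smul_eq (c : ℂ) (v : Cn n) : c • v = c.re • v + c.im • cplxJ n v := by
  conv_lhs => rw [← Complex.re_add_im c]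
  rw [add_smul, cplxJ_apply, mul_smul]
  rfl

/-- A positive real `(1, 1)`-form on `ℂⁿ`: a real `2`-form `η` that is invariant under `J` and for
which `η(v, J v) > 0` whenever `v ≠ 0`. -/
structure IsPosOneOne (η : Cn n [⋀^Fin 2]→L[ℝ] ℝ) : Prop where
  invariant : ∀ v w : Cn n, η ![cplxJ n v, cplxJ n w] = η ![v, w]
  pos : ∀ v : Cn n, v ≠ 0 → 0 < η ![v, cplxJ n v]

variable {η η₁ η₂ : Cn n [⋀^Fin 2]→L[ℝ] ℝ}

theorem twoForm_add_left (η : Cn n [⋀^Fin 2]→L[ℝ] ℝ) (v v' w : Cn n) :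
    η ![v + v', w] = η ![v, w] + η ![v', w] := η.map_vecCons_add _ v v'

theorem twoForm_smul_left (η : Cn n [⋀^Fin 2]→L[ℝ] ℝ) (c : ℝ) (v w : Cn n) :
    η ![c • v, w] = c * η ![v, w] := η.map_vecCons_smul _ c v

theorem twoForm_swap (η : Cn n [⋀^Fin 2]→L[ℝ] ℝ) (v w : Cn n) : η ![v, w] = -η ![w, v] := by
  have := η.toAlternatingMap.map_swap ![w, v] (i := 0) (j := 1) (by decide)
  refine Eq.trans ?_ this
  change _ = η _
  congr 1
  ext i j
  fin_cases i <;> rfl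

theorem twoForm_smul_right (η : Cn n [⋀^Fin 2]→L[ℝ] ℝ) (c : ℝ) (v w : Cn n) :
    η ![v, c • w] = c * η ![v, w] := by
  rw [twoForm_swap, twoForm_smul_left, twoForm_swap η w]; ring

theorem twoForm_smul_cplxJ_smul (η : Cn n [⋀^Fin 2]→L[ℝ] ℝ) (c : ℝ) (v : Cn n) :
    η ![c • v, cplxJ n (c • v)] = c ^ 2 * η ![v, cplxJ n v] := by
  rw [map_smul, twoForm_smul_left, twoForm_smul_right]; ring

theorem twoForm_self (η : Cn n [⋀^Fin 2]→L[ℝ] ℝ) (v : Cn n) : η ![v, v] = 0 := by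
  have := twoForm_swap η v v
  linarith

/-- The Hermitian form `h(v, w) = η(v, J w) - i η(v, w)` of a `2`-form `η` on `ℂⁿ`. -/
def hermForm (η : Cn n [⋀^Fin 2]→L[ℝ] ℝ) (v w : Cn n) : ℂ :=
  (η ![v, cplxJ n w] : ℂ) - Complex.I * (η ![v, w] : ℂ)

theorem hermForm_self (η : Cn n [⋀^Fin 2]→L[ℝ] ℝ) (v : Cn n) :
    hermForm η v v = (η ![v, cplxJ n v] : ℂ) := by
  simp [hermForm, twoForm_self]

namespace IsPosOneOne

theorem apply_cplxJ_left (hη : IsPosOneOne η) (v w : Cn n) :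
    η ![cplxJ n v, w] = -η ![v, cplxJ n w] := by
  rw [← hη.invariant v, cplxJ_cplxJ, ← neg_one_smul ℝ w, twoForm_smul_right]; ring

theorem star_hermForm (hη : IsPosOneOne η) (v w : Cn n) :
    star (hermForm η v w) = hermForm η w v := by
  have h1 : η ![w, cplxJ n v] = η ![v, cplxJ n w] := by
    rw [twoForm_swap, hη.apply_cplxJ_left, neg_neg]
  simp [hermForm, h1, twoForm_swap η w v]

/-- The Hermitian form of a positive `(1, 1)`-form, as a sesquilinear map (conjugate linear in the
second variable). -/
def sesq (hη : IsPosOneOne η) : Cn n →ₗ[ℂ] Cn n →ₗ⋆[ℂ] ℂ :=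
  have hadd (v v' w : Cn n) : hermForm η (v + v') w = hermForm η v w + hermForm η v' w := by
    simp only [hermForm, twoForm_add_left]; push_cast; ring
  have hsmul (c : ℂ) (v w : Cn n) : hermForm η (c • v) w = c • hermForm η v w := by
    have h : hermForm η (c • v) w = c.re * hermForm η v w + c.im * hermForm η (cplxJ n v) w := by
      simp only [hermForm, complex_smul_eq c v, twoForm_add_left, twoForm_smul_left]
      push_cast; ring
    have hJ : hermForm η (cplxJ n v) w = Complex.I * hermForm η v w := by
      simp only [hermForm, hη.invariant, hη.apply_cplxJ_left v w]
      push_cast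
      linear_combination (η ![v, w] : ℂ) * Complex.I_sq
    rw [h, hJ]
    conv_rhs => rw [← Complex.re_add_im c]
    rw [smul_eq_mul]; ring
  LinearMap.mk₂'ₛₗ (RingHom.id ℂ) (starRingEnd ℂ) (hermForm η) hadd
    (fun c v w => hsmul c v w)
    (fun v w w' => by
      rw [← hη.star_hermForm, hadd, star_add, hη.star_hermForm, hη.star_hermForm])
    (fun c v w => by
      rw [← hη.star_hermForm, hsmul, star_smul, hη.star_hermForm]; rfl)

@[simp]
theorem sesq_apply (hη : IsPosOneOne η) (v w : Cn n) : hη.sesq v w = hermForm η v w := rfl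

theorem hermForm_sum_smul (hη : IsPosOneOne η) (a b : Fin n → ℂ) (e f : Fin n → Cn n) :
    hermForm η (∑ i, a i • e i) (∑ k, b k • f k) =
      ∑ i, ∑ k, a i * star (b k) * hermForm η (e i) (f k) := by
  rw [← hη.sesq_apply]
  simp only [map_sum, map_smul, LinearMap.sum_apply, LinearMap.smul_apply, LinearMap.map_smulₛₗ,
    sesq_apply, smul_eq_mul, Finset.mul_sum]
  rw [Finset.sum_comm]
  refine Finset.sum_congr rfl fun i _ => Finset.sum_congr rfl fun k _ => ?_
  simp; ring

/-- Change of basis. The conjugation is there because `hermForm` is linear in its first variable. -/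
theorem of_hermForm_eq (hη : IsPosOneOne η) (e : Fin n → Cn n) :
    (Matrix.of fun j k => hermForm η (e j) (e k)) =
      (Matrix.of fun i j => star (e j i)).conjTranspose * hermMatrix η *
        Matrix.of fun i j => star (e j i) := by
  have hsum (v : Cn n) : v = ∑ i, v i • (EuclideanSpace.single i (1 : ℂ) : Cn n) := by
    have := (EuclideanSpace.basisFun (Fin n) ℂ).sum_repr v
    simpa using this.symm
  ext j k
  simp only [Matrix.of_apply]
  rw [hsum (e j), hsum (e k), hη.hermForm_sum_smul]
  simp only [Matrix.mul_apply, Matrix.conjTranspose_apply, Matrix.of_apply, star_star,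
    Finset.sum_mul]
  rw [Finset.sum_comm]
  refine Finset.sum_congr rfl fun i _ => Finset.sum_congr rfl fun l _ => ?_
  simp only [hermMatrix, hermForm, Matrix.of_apply]
  ring

theorem det_of_hermForm (hη : IsPosOneOne η) (e : Fin n → Cn n) :
    (Matrix.of fun j k => hermForm η (e j) (e k)).det =
      (Complex.normSq (Matrix.of fun i j => star (e j i)).det : ℂ) * (hermMatrix η).det := by
  rw [hη.of_hermForm_eq, Matrix.det_mul, Matrix.det_mul, Matrix.det_conjTranspose,
    Complex.normSq_eq_conj_mul_self]
  simp only [RCLike.star_def]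
  ring

theorem hermMatrix_posDef (hη : IsPosOneOne η) : (hermMatrix η).PosDef := by
  have hH : hermMatrix η = Matrix.of fun j k =>
      hermForm η (EuclideanSpace.single j 1) (EuclideanSpace.single k 1) := rfl
  refine Matrix.PosDef.of_dotProduct_mulVec_pos ?_ fun x hx => ?_
  · ext j k
    rw [hH, Matrix.conjTranspose_apply, Matrix.of_apply, Matrix.of_apply, hη.star_hermForm]
  · set v : Cn n := ∑ i, star (x i) • (EuclideanSpace.single i (1 : ℂ) : Cn n) with hv
    have hvi (i : Fin n) : v i = star (x i) := by
      simp [hv, Finset.sum_apply, Pi.single_apply]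
    have hv0 : v ≠ 0 := by
      rintro h
      refine hx (funext fun i => ?_)
      have := hvi i
      rw [h] at this
      simpa using this.symm
    have : star x ⬝ᵥ (hermMatrix η).mulVec x = hermForm η v v := by
      rw [hv, hη.hermForm_sum_smul]
      simp only [dotProduct, Matrix.mulVec, hH, Matrix.of_apply, Finset.mul_sum, star_star,
        Pi.star_apply]
      refine Finset.sum_congr rfl fun i _ => Finset.sum_congr rfl fun k _ => ?_
      ring
    rw [this, hermForm_self]
    exact_mod_cast hη.pos v hv0

theorem det_hermMatrix_pos (hη : IsPosOneOne η) : 0 < (hermMatrix η).det.re :=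
  (Complex.pos_iff.1 hη.hermMatrix_posDef.det_pos).1

theorem ofReal_det_hermMatrix (hη : IsPosOneOne η) :
    ((hermMatrix η).det.re : ℂ) = (hermMatrix η).det :=
  Complex.ext rfl (by simpa using (Complex.pos_iff.1 hη.hermMatrix_posDef.det_pos).2)

end IsPosOneOne

theorem exists_simultaneous_diagonalization {ι : Type*} [Fintype ι] [DecidableEq ι]
    {A B : Matrix ι ι ℂ} (hA : A.PosDef) (hB : B.IsHermitian) :
    ∃ (P : Matrix ι ι ℂ) (l : ι → ℝ), P.conjTranspose * A * P = 1 ∧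
      P.conjTranspose * B * P = Matrix.diagonal fun i => (l i : ℂ) := by
  have diag {M : Matrix ι ι ℂ} (hM : M.IsHermitian) :
      ∃ U : Matrix ι ι ℂ, U.conjTranspose * U = 1 ∧
        U.conjTranspose * M * U = Matrix.diagonal fun i => (hM.eigenvalues i : ℂ) := by
    refine ⟨hM.eigenvectorUnitary, ?_, ?_⟩
    · rw [← Matrix.star_eq_conjTranspose]; exact Unitary.coe_star_mul_self _
    · have := hM.conjStarAlgAut_star_eigenvectorUnitary
      rw [Unitary.conjStarAlgAut_star_apply] at this
      exact this
  -- `U` diagonalizes `A`, rescaling by `D` makes `A` the identity, and `W` then diagonalizes `B`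
  obtain ⟨U, -, hU⟩ := diag hA.1
  set d := hA.1.eigenvalues with hd
  have hdpos (i : ι) : 0 < d i := hA.eigenvalues_pos i
  set D : Matrix ι ι ℂ := Matrix.diagonal fun i => ((Real.sqrt (d i))⁻¹ : ℂ) with hD
  have hDs : D.conjTranspose = D := by
    rw [hD, Matrix.diagonal_conjTranspose]
    congr 1; funext i; simp
  have hQA : (U * D).conjTranspose * A * (U * D) = 1 := by
    have : (U * D).conjTranspose * A * (U * D) = D * (U.conjTranspose * A * U) * D := by
      rw [Matrix.conjTranspose_mul, hDs]; simp only [Matrix.mul_assoc]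
    rw [this, hU, hD, Matrix.diagonal_mul_diagonal, Matrix.diagonal_mul_diagonal,
      ← Matrix.diagonal_one]
    congr 1; funext i
    have h1 : ((Real.sqrt (d i) : ℝ) : ℂ) ≠ 0 := by
      exact_mod_cast (Real.sqrt_pos.2 (hdpos i)).ne'
    have h2 : ((Real.sqrt (d i) : ℝ) : ℂ) * (Real.sqrt (d i) : ℝ) = d i := by
      exact_mod_cast Real.mul_self_sqrt (hdpos i).le
    field_simp
    rw [← h2]; ring
  have hC : ((U * D).conjTranspose * B * (U * D)).IsHermitian :=
    Matrix.isHermitian_conjTranspose_mul_mul _ hB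
  obtain ⟨W, hW1, hW2⟩ := diag hC
  refine ⟨U * D * W, hC.eigenvalues, ?_, ?_⟩
  · have : (U * D * W).conjTranspose * A * (U * D * W) =
        W.conjTranspose * ((U * D).conjTranspose * A * (U * D)) * W := by
      rw [Matrix.conjTranspose_mul (U * D) W]; simp only [Matrix.mul_assoc]
    rw [this, hQA, Matrix.mul_one, hW1]
  · rw [← hW2, Matrix.conjTranspose_mul (U * D) W]; simp only [Matrix.mul_assoc]

/-- Simultaneous diagonalization of two positive `(1, 1)`-forms: a basis `e` of `ℂⁿ` that is unitary
for `η₁` and orthogonal for `η₂`. The number `D` is the squared modulus of the determinant of the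
change of basis. -/
theorem exists_adapted_frame (h₁ : IsPosOneOne η₁) (h₂ : IsPosOneOne η₂) :
    ∃ (e : Fin n → Cn n) (l : Fin n → ℝ) (D : ℝ), 0 < D ∧
      (∀ i k, hermForm η₁ (e i) (e k) = if i = k then 1 else 0) ∧
      (∀ i, η₁ ![e i, cplxJ n (e i)] = 1) ∧ (∀ i, η₂ ![e i, cplxJ n (e i)] = l i) ∧
      (∀ i, 0 < l i) ∧
      D * (hermMatrix η₁).det.re = 1 ∧ D * (hermMatrix η₂).det.re = ∏ i, l i := by
  obtain ⟨P, l, hP1, hP2⟩ := exists_simultaneous_diagonalization h₁.hermMatrix_posDef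
    h₂.hermMatrix_posDef.isHermitian
  set e : Fin n → Cn n := fun i => WithLp.toLp 2 fun j => star (P j i) with he
  have hPe : P = Matrix.of fun i j => star (e j i) := by
    ext i j; simp [he]
  rw [hPe, ← h₁.of_hermForm_eq] at hP1
  rw [hPe, ← h₂.of_hermForm_eq] at hP2
  have hd1 := h₁.det_of_hermForm e
  have hd2 := h₂.det_of_hermForm e
  rw [hP1, Matrix.det_one, ← h₁.ofReal_det_hermMatrix] at hd1
  rw [hP2, Matrix.det_diagonal, ← h₂.ofReal_det_hermMatrix] at hd2
  set D := Complex.normSq (Matrix.of fun i j => star (e j i)).det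
  have hD1 : 1 = D * (hermMatrix η₁).det.re := by exact_mod_cast hd1
  have hD2 : ∏ i, l i = D * (hermMatrix η₂).det.re := by exact_mod_cast hd2
  have hDpos : 0 < D := by
    have := h₁.det_hermMatrix_pos
    by_contra! h
    nlinarith
  have hη₁ (i k : Fin n) : hermForm η₁ (e i) (e k) = if i = k then 1 else 0 := by
    have := congrFun (congrFun hP1 i) k
    rwa [Matrix.of_apply, Matrix.one_apply] at this
  have hη₁' (i : Fin n) : η₁ ![e i, cplxJ n (e i)] = 1 := by
    have := hη₁ i i
    rw [hermForm_self, if_pos rfl] at this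
    exact_mod_cast this
  have hη₂ (i : Fin n) : η₂ ![e i, cplxJ n (e i)] = l i := by
    have := congrFun (congrFun hP2 i) i
    rw [Matrix.of_apply, Matrix.diagonal_apply_eq, hermForm_self] at this
    exact_mod_cast this
  refine ⟨e, l, D, hDpos, hη₁, hη₁', hη₂, fun i => ?_, hD1.symm, hD2.symm⟩
  rw [← hη₂ i]
  refine h₂.pos _ fun h0 => ?_
  have := hη₁' i
  rw [h0, ← zero_smul ℝ (0 : Cn n), twoForm_smul_left, zero_mul] at this
  exact zero_ne_one this

/-- An upper bound for `η` gives the ellipticity of the operator `∑ i∂∂̄u(eᵢ, J eᵢ)` that belongs to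
a unitary basis `e` of `η`. -/
theorem norm_sq_le_of_hermForm_orthonormal (hη : IsPosOneOne η) {e : Fin n → Cn n}
    (he : ∀ i k, hermForm η (e i) (e k) = if i = k then 1 else 0) {M : ℝ} (hM : 0 < M)
    (hηM : ∀ v, η ![v, cplxJ n v] ≤ M * ‖v‖ ^ 2) (ξ : Cn n) :
    M⁻¹ * ‖ξ‖ ^ 2 ≤ ∑ i, ‖inner ℂ ξ (e i)‖ ^ 2 := by
  have hli : LinearIndependent ℂ e := by
    rw [Fintype.linearIndependent_iff]
    intro g hg i
    have h := congrArg (fun v => hη.sesq v (e i)) hg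
    simpa [he] using h
  set b := Module.Basis.mk hli (hli.span_eq_top_of_card_eq_finrank' (by simp)).ge with hb
  set c := b.repr ξ with hc
  have hξ : ∑ i, c i • e i = ξ := by
    have := b.sum_repr ξ
    rwa [hb, Module.Basis.coe_mk] at this
  set a : Fin n → ℂ := fun i => inner ℂ ξ (e i) with ha
  have hc2 : η ![ξ, cplxJ n ξ] = ∑ i, ‖c i‖ ^ 2 := by
    have h := hη.hermForm_sum_smul c c e e
    rw [hξ, hermForm_self] at h
    simp only [he, mul_ite, mul_one, mul_zero, Finset.sum_ite_eq, Finset.mem_univ, if_true] at h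
    have h2 : ∀ i, c i * star (c i) = ((‖c i‖ ^ 2 : ℝ) : ℂ) := fun i => by
      rw [RCLike.star_def, Complex.mul_conj, Complex.normSq_eq_norm_sq]
    simp only [h2] at h
    exact_mod_cast h
  have hξ2 : ‖ξ‖ ^ 2 = ∑ i, (c i * a i).re := by
    have h1 : (inner ℂ ξ ξ : ℂ) = ∑ i, c i * a i := by
      conv_lhs => rw [← hξ]
      rw [hξ, ← hξ, inner_sum]
      simp only [inner_smul_right, hξ, ha]
    have h2 := inner_self_eq_norm_sq_to_K (𝕜 := ℂ) ξ
    rw [h1] at h2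
    have h3 := congrArg Complex.re h2
    rw [Complex.re_sum] at h3
    rw [h3]
    norm_cast
  have hpt (i : Fin n) : 0 ≤ M ^ 2 * ‖a i‖ ^ 2 - 2 * M * (c i * a i).re + ‖c i‖ ^ 2 := by
    have h1 : ‖a i‖ ^ 2 = (a i).re ^ 2 + (a i).im ^ 2 := by
      rw [← Complex.normSq_eq_norm_sq, Complex.normSq_apply]; ring
    have h2 : ‖c i‖ ^ 2 = (c i).re ^ 2 + (c i).im ^ 2 := by
      rw [← Complex.normSq_eq_norm_sq, Complex.normSq_apply]; ring
    rw [h1, h2, Complex.mul_re]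
    nlinarith [sq_nonneg (M * (a i).re - (c i).re), sq_nonneg (M * (a i).im + (c i).im)]
  have hs := Finset.sum_nonneg fun i (_ : i ∈ Finset.univ) => hpt i
  rw [Finset.sum_add_distrib, Finset.sum_sub_distrib, ← Finset.mul_sum, ← Finset.mul_sum, ← hξ2,
    ← hc2] at hs
  have h4 := hηM ξ
  have h5 : M * ‖ξ‖ ^ 2 ≤ M * (M * ∑ i, ‖a i‖ ^ 2) := by nlinarith
  have h6 := le_of_mul_le_mul_left h5 hM
  rw [inv_mul_le_iff₀ hM]
  exact h6

theorem det_le_of_forall_le (h₁ : IsPosOneOne η₁) (h₂ : IsPosOneOne η₂) {a : ℝ}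
    (hle : ∀ v, η₂ ![v, cplxJ n v] ≤ a * η₁ ![v, cplxJ n v]) :
    (hermMatrix η₂).det.re ≤ a ^ n * (hermMatrix η₁).det.re := by
  obtain ⟨e, l, D, hD, -, he1, he2, hl, hD1, hD2⟩ := exists_adapted_frame h₁ h₂
  have : ∏ i, l i ≤ a ^ n := by
    refine (Finset.prod_le_prod (fun i _ => (hl i).le) (g := fun _ => a) fun i _ => ?_).trans ?_
    · have := hle (e i)
      rwa [he1, he2, mul_one] at this
    · simp
  refine le_of_mul_le_mul_left ?_ hD
  calc D * (hermMatrix η₂).det.re = ∏ i, l i := hD2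
    _ ≤ a ^ n := this
    _ = D * (a ^ n * (hermMatrix η₁).det.re) := by rw [mul_left_comm, hD1, mul_one]

/-- The inequality of the arithmetic and geometric means, in the form that linearizes `∏ lᵢ = 1`. -/
theorem sum_sub_one_nonneg_of_prod_eq_one {ι : Type*} [Fintype ι] {l : ι → ℝ} (hl : ∀ i, 0 < l i)
    (hprod : ∏ i, l i = 1) : 0 ≤ ∑ i, (l i - 1) := by
  have h := Real.log_prod (s := Finset.univ) (f := l) fun i _ => (hl i).ne'
  rw [hprod, Real.log_one] at h
  rw [h]
  exact Finset.sum_le_sum fun i _ => Real.log_le_sub_one_of_pos (hl i)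

theorem IsPosOneOne.exists_lower_bound (hη : IsPosOneOne η) :
    ∃ c : ℝ, 0 < c ∧ ∀ v, c * ‖v‖ ^ 2 ≤ η ![v, cplxJ n v] := by
  have hcont : Continuous fun v : Cn n => η ![v, cplxJ n v] := by
    refine η.cont.comp (continuous_pi fun i => ?_)
    fin_cases i
    · exact continuous_id
    · exact (cplxJ n).continuous
  rcases (Metric.sphere (0 : Cn n) 1).eq_empty_or_nonempty with he | hne
  · refine ⟨1, one_pos, fun v => ?_⟩
    have hv : v = 0 := by
      by_contra hv
      have : (‖v‖⁻¹ : ℝ) • v ∈ Metric.sphere (0 : Cn n) 1 := by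
        simp [norm_smul, hv]
      rw [he] at this
      exact this
    rw [hv, ← zero_smul ℝ (0 : Cn n), twoForm_smul_left]; simp
  · obtain ⟨w, hw, hwmin⟩ := (isCompact_sphere (0 : Cn n) 1).exists_isMinOn hne hcont.continuousOn
    have hw0 : w ≠ 0 := by
      rintro rfl; simp at hw
    refine ⟨η ![w, cplxJ n w], hη.pos w hw0, fun v => ?_⟩
    by_cases hv : v = 0
    · rw [hv, norm_zero, ← zero_smul ℝ (0 : Cn n), twoForm_smul_left]; simp
    · have hvn : 0 < ‖v‖ := norm_pos_iff.2 hv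
      have hmem : (‖v‖⁻¹ : ℝ) • v ∈ Metric.sphere (0 : Cn n) 1 := by
        simp [norm_smul, hv]
      have h : η ![w, cplxJ n w] ≤ η ![(‖v‖⁻¹ : ℝ) • v, cplxJ n ((‖v‖⁻¹ : ℝ) • v)] := hwmin hmem
      rw [twoForm_smul_cplxJ_smul] at h
      calc η ![w, cplxJ n w] * ‖v‖ ^ 2
          ≤ ‖v‖⁻¹ ^ 2 * η ![v, cplxJ n v] * ‖v‖ ^ 2 := by gcongr
        _ = η ![v, cplxJ n v] := by field_simp

theorem norm_cplxJ (v : Cn n) : ‖cplxJ n v‖ = ‖v‖ := by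
  simp [cplxJ_apply, norm_smul]

theorem abs_twoForm_cplxJ_le (η : Cn n [⋀^Fin 2]→L[ℝ] ℝ) (v : Cn n) :
    |η ![v, cplxJ n v]| ≤ ‖η‖ * ‖v‖ ^ 2 := by
  have := η.le_opNorm ![v, cplxJ n v]
  simpa [Fin.prod_univ_two, norm_cplxJ, ← sq] using this

theorem inner_sq_add_inner_cplxJ_sq (ξ v : Cn n) :
    inner ℝ ξ v ^ 2 + inner ℝ ξ (cplxJ n v) ^ 2 = ‖inner ℂ ξ v‖ ^ 2 := by
  have h (w : Cn n) : inner ℝ ξ w = (inner ℂ ξ w).re := by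
    simp [PiLp.inner_apply, Complex.inner]
  rw [h, h, cplxJ_apply, inner_smul_right, ← Complex.normSq_eq_norm_sq, Complex.normSq_apply]
  simp
  ring

end Hermitian

/-! ### The complex Hessian -/

section ComplexHessian

variable {n : ℕ}

theorem dbar_apply (f : Cn n → ℝ) (y : Cn n) (v : Fin 1 → Cn n) :
    dbar f y v = (1 / 2 : ℂ) * ((fderiv ℝ f y (v 0) : ℂ) +
      Complex.I * (fderiv ℝ f y (cplxJ n (v 0)) : ℂ)) := by
  simp [dbar, mul_add]

/-- On the pair `(v, J v)`, the form `i∂∂̄f` is half the Laplacian of `f` on the complex line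
of `v`. -/
theorem iddbar_apply_cplxJ {f : Cn n → ℝ} {y : Cn n} (hf : ContDiffAt ℝ 2 f y) (v : Cn n) :
    iddbar f y ![v, cplxJ n v] =
      ((1 / 2 * (fderiv ℝ (fderiv ℝ f) y v v +
        fderiv ℝ (fderiv ℝ f) y (cplxJ n v) (cplxJ n v)) : ℝ) : ℂ) := by
  have hd : DifferentiableAt ℝ (fderiv ℝ f) y :=
    (hf.fderiv_right (m := 1) (by norm_num)).differentiableAt (by simp)
  have hdbar : DifferentiableAt ℝ (dbar f) y := by
    have h (L : Cn n →L[ℝ] Cn n) : DifferentiableAt ℝ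
        (fun x => Complex.ofRealCLM.comp ((fderiv ℝ f x).comp L)) y := by fun_prop
    have h' : DifferentiableAt ℝ (fun x => (1 / 2 : ℂ) • (Complex.ofRealCLM.comp (fderiv ℝ f x) +
      Complex.I • Complex.ofRealCLM.comp ((fderiv ℝ f x).comp (cplxJ n)))) y :=
        ((h (.id ℝ _)).add ((h _).fun_const_smul Complex.I)).fun_const_smul (1 / 2 : ℂ)
    exact (ContinuousAlternatingMap.ofSubsingletonLIE (𝕜 := ℝ) (E := Cn n) (F := ℂ)
      (0 : Fin 1)).differentiableAt.comp y h'
  have key (a b : Cn n) : fderiv ℝ (fun x => dbar f x ![b]) y a =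
      (1 / 2 : ℂ) * ((fderiv ℝ (fderiv ℝ f) y a b : ℂ) +
        Complex.I * (fderiv ℝ (fderiv ℝ f) y a (cplxJ n b) : ℂ)) := by
    have h (w : Cn n) : HasFDerivAt (fun x => ((fderiv ℝ f x w : ℝ) : ℂ))
        (Complex.ofRealCLM.comp ((fderiv ℝ (fderiv ℝ f) y).flip w)) y := by
      have := hd.hasFDerivAt.clm_apply (hasFDerivAt_const w y)
      refine (Complex.ofRealCLM.hasFDerivAt.comp y this).congr_fderiv ?_
      ext; simp
    have h2 := ((h b).add ((h (cplxJ n b)).const_mul Complex.I)).const_mul (1 / 2 : ℂ)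
    have h3 : (fun x => dbar f x ![b]) = fun x => (1 / 2 : ℂ) * ((fderiv ℝ f x b : ℂ) +
      Complex.I * (fderiv ℝ f x (cplxJ n b) : ℂ)) := by
      funext x; rw [dbar_apply]; rfl
    rw [h3]
    refine (congrArg (fun L => L a) h2.fderiv).trans ?_
    simp [mul_add]
  have hsymm : IsSymmSndFDerivAt ℝ f y := hf.isSymmSndFDerivAt (by simp)
  have h1 : extDeriv (dbar f) y ![v, cplxJ n v] =
      fderiv ℝ (fun x => dbar f x ![cplxJ n v]) y v -
        fderiv ℝ (fun x => dbar f x ![v]) y (cplxJ n v) := by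
    rw [extDeriv_apply hdbar]
    rw [Fin.sum_univ_two]
    have h0 : Fin.removeNth 1 ![v, cplxJ n v] = ![v] := by
      ext i; fin_cases i; rfl
    rw [h0]
    simp [sub_eq_add_neg]
  rw [iddbar, ContinuousAlternatingMap.smul_apply, h1, key, key, cplxJ_cplxJ,
    hsymm.eq v (cplxJ n v), map_neg, smul_eq_mul]
  push_cast
  linear_combination (-1 / 2 : ℂ) * ((fderiv ℝ (fderiv ℝ f) y v v : ℂ) +
    (fderiv ℝ (fderiv ℝ f) y (cplxJ n v) (cplxJ n v) : ℂ)) * Complex.I_sq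

theorem iddbar_congr {f g : Cn n → ℝ} {y : Cn n} (h : f =ᶠ[𝓝 y] g) :
    iddbar f y = iddbar g y := by
  have h1 : dbar f =ᶠ[𝓝 y] dbar g := by
    filter_upwards [h.eventuallyEq_nhds] with z hz
    rw [dbar, dbar, hz.fderiv_eq]
  rw [iddbar, iddbar, extDeriv, extDeriv, h1.fderiv_eq]

theorem iddbar_const (c : ℝ) (y : Cn n) : iddbar (fun _ => c) y = 0 := by
  have h : dbar (fun _ : Cn n => c) = fun _ => 0 := by
    funext z
    ext v
    simp [dbar_apply]
  rw [iddbar, extDeriv, h, fderiv_const_apply]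
  ext v
  simp [ContinuousAlternatingMap.alternatizeUncurryFin_apply]

theorem iddbar_sub_apply_cplxJ {f g : Cn n → ℝ} {y : Cn n} (hf : ContDiffAt ℝ 2 f y)
    (hg : ContDiffAt ℝ 2 g y) (v : Cn n) :
    iddbar (fun z => f z - g z) y ![v, cplxJ n v] =
      iddbar f y ![v, cplxJ n v] - iddbar g y ![v, cplxJ n v] := by
  rw [iddbar_apply_cplxJ (hf.sub hg), iddbar_apply_cplxJ hf, iddbar_apply_cplxJ hg]
  have h1 : fderiv ℝ (fun z => f z - g z) =ᶠ[𝓝 y] fun z => fderiv ℝ f z - fderiv ℝ g z := by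
    filter_upwards [hf.eventually (by simp), hg.eventually (by simp)] with z hz hz'
    exact fderiv_fun_sub (hz.differentiableAt (by simp)) (hz'.differentiableAt (by simp))
  have h2 {f : Cn n → ℝ} (hf : ContDiffAt ℝ 2 f y) : DifferentiableAt ℝ (fderiv ℝ f) y :=
    (hf.fderiv_right (m := 1) (by norm_num)).differentiableAt (by simp)
  rw [h1.fderiv_eq, fderiv_fun_sub (h2 hf) (h2 hg)]
  simp
  ring

theorem iddbar_neg_apply_cplxJ {f : Cn n → ℝ} {y : Cn n} (hf : ContDiffAt ℝ 2 f y) (v : Cn n) :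
    iddbar (fun z => -f z) y ![v, cplxJ n v] = -iddbar f y ![v, cplxJ n v] := by
  have h := iddbar_sub_apply_cplxJ (f := fun _ => 0) contDiffAt_const hf v
  simp only [zero_sub] at h
  rw [h, iddbar_const]
  simp

theorem iddbar_re_nonpos_of_isLocalMax {f : Cn n → ℝ} {y : Cn n} (hf : ContDiffAt ℝ 2 f y)
    (hmax : IsLocalMax f y) (v : Cn n) : (iddbar f y ![v, cplxJ n v]).re ≤ 0 := by
  rw [iddbar_apply_cplxJ hf, Complex.ofReal_re]
  have h1 := fderiv_fderiv_apply_self_nonpos_of_isLocalMax hf hmax v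
  have h2 := fderiv_fderiv_apply_self_nonpos_of_isLocalMax hf hmax (cplxJ n v)
  linarith

/-- The strong maximum principle for operators `f ↦ ∑ i∂∂̄f(eᵢ, J eᵢ)`. -/
theorem eventually_eq_of_isMaxOn_of_sum_iddbar_nonneg {f : Cn n → ℝ} {p : Cn n} {U : Set (Cn n)}
    (hU : IsOpen U) (hpU : p ∈ U) (hf : ContDiffOn ℝ 2 f U) {c C : ℝ} (hc : 0 < c)
    (hell : ∀ z ∈ U, ∃ e : Fin n → Cn n, (∀ i, ‖e i‖ ≤ C) ∧
      (∀ ξ : Cn n, c * ‖ξ‖ ^ 2 ≤ ∑ i, ‖inner ℂ ξ (e i)‖ ^ 2) ∧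
      0 ≤ ∑ i, (iddbar f z ![e i, cplxJ n (e i)]).re)
    (hmax : ∀ z ∈ U, f z ≤ f p) : ∀ᶠ z in 𝓝 p, f z = f p := by
  refine eventually_eq_of_isMaxOn_of_elliptic (ι := Fin n ⊕ Fin n) hU hpU hf (C := C) hc
    (fun z hz => ?_) hmax
  obtain ⟨e, he, hξ, hsum⟩ := hell z hz
  refine ⟨Sum.elim e fun i => cplxJ n (e i), ?_, fun ξ => ?_, ?_⟩
  · rintro (i | i)
    · exact he i
    · simpa [norm_cplxJ] using he i
  · refine (hξ ξ).trans_eq ?_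
    simp only [Fintype.sum_sum_type, Sum.elim_inl, Sum.elim_inr, ← Finset.sum_add_distrib,
      inner_sq_add_inner_cplxJ_sq]
  · simp only [iddbar_apply_cplxJ (hf.contDiffAt (hU.mem_nhds hz)), Complex.ofReal_re,
      ← Finset.mul_sum] at hsum
    simp only [Fintype.sum_sum_type, Sum.elim_inl, Sum.elim_inr, ← Finset.sum_add_distrib]
    linarith

end ComplexHessian

/-! ### Kähler forms in holomorphic charts -/

section Charts

theorem isManifold_real_of_complex {n : ℕ} (X : Type*) [TopologicalSpace X]
    [ChartedSpace (Cn n) X] [IsManifold 𝓘(ℂ, Cn n) ∞ X] : IsManifold 𝓘(ℝ, Cn n) ∞ X := by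
  refine isManifold_of_contDiffOn _ _ _ fun e e' he he' => ?_
  have h := (contDiffGroupoid ∞ 𝓘(ℂ, Cn n)).compatible he he'
  have h2 := (mem_groupoid_of_pregroupoid.1 h).1
  exact (ContDiffOn.restrict_scalars ℝ h2 : _)

section RealManifold

variable {V : Type*} [NormedAddCommGroup V] [NormedSpace ℝ V]
  {H : Type*} [TopologicalSpace H] {I : ModelWithCorners ℝ V H} [I.Boundaryless]
  {N : Type*} [TopologicalSpace N] [ChartedSpace H N] [IsManifold I 1 N]

theorem chartFrame_bijective {p₀ : N} {y : V} (hy : y ∈ (extChartAt I p₀).target) :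
    Function.Bijective (chartFrame I p₀ y : V → V) := by
  have h := isInvertible_mfderivWithin_extChartAt_symm (I := I) hy
  rw [I.range_eq_univ, mfderivWithin_univ] at h
  exact h.bijective

end RealManifold

variable {n : ℕ} {X : Type*} [TopologicalSpace X] [ChartedSpace (Cn n) X]

/-- The inverse of a holomorphic chart is holomorphic. The tangent space at a point is read in the
preferred chart there, so this is the holomorphy of a transition map. -/
theorem chartFrame_cplxJ [IsManifold 𝓘(ℂ, Cn n) ∞ X] {x₀ : X} {y : Cn n}
    (hy : y ∈ (extChartAt 𝓘(ℝ, Cn n) x₀).target) (v : Cn n) :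
    (chartFrame 𝓘(ℝ, Cn n) x₀ y (cplxJ n v) : Cn n) =
      cplxJ n (chartFrame 𝓘(ℝ, Cn n) x₀ y v : Cn n) := by
  have := isManifold_real_of_complex (n := n) X
  have : IsManifold 𝓘(ℝ, Cn n) 1 X := .of_le (n := ∞) (by norm_cast)
  set x := (extChartAt 𝓘(ℝ, Cn n) x₀).symm y with hx
  set g : Cn n → Cn n := chartAt (Cn n) x ∘ (chartAt (Cn n) x₀).symm with hg
  have hd : DifferentiableAt ℂ g y := by
    have h := (contDiffGroupoid ∞ 𝓘(ℂ, Cn n)).compatible (chart_mem_atlas (Cn n) x₀)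
      (chart_mem_atlas (Cn n) x)
    have h2 := (mem_groupoid_of_pregroupoid.1 h).1
    have h3 : ContDiffOn ℂ ∞ g ((chartAt (Cn n) x₀).symm.trans (chartAt (Cn n) x)).source := by
      simpa [contDiffPregroupoid, hg] using h2
    refine (h3.contDiffAt
      (IsOpen.mem_nhds (OpenPartialHomeomorph.open_source _) ?_)).differentiableAt (by simp)
    have hy' : y ∈ (chartAt (Cn n) x₀).target := by simpa using hy
    simp [hy', hx]
  have hfr : (chartFrame 𝓘(ℝ, Cn n) x₀ y : Cn n →L[ℝ] Cn n) = (fderiv ℂ g y).restrictScalars ℝ := by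
    have hm : MDifferentiableAt 𝓘(ℝ, Cn n) 𝓘(ℝ, Cn n) (extChartAt 𝓘(ℝ, Cn n) x₀).symm y := by
      have := mdifferentiableWithinAt_extChartAt_symm (I := 𝓘(ℝ, Cn n)) hy
      rwa [ModelWithCorners.range_eq_univ, mdifferentiableWithinAt_univ] at this
    have h1 : (chartFrame 𝓘(ℝ, Cn n) x₀ y : Cn n →L[ℝ] Cn n) = fderiv ℝ g y := by
      unfold chartFrame
      rw [hm.mfderiv]
      simp only [ModelWithCorners.range_eq_univ, fderivWithin_univ]
      rfl
    rw [h1]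
    exact (hd.hasFDerivAt.restrictScalars ℝ).fderiv
  rw [hfr, cplxJ_apply]
  exact (fderiv ℂ g y).map_smul Complex.I v

theorem formInChart_apply (η : TwoForm n X) (x₀ : X) (y v w : Cn n) :
    formInChart 𝓘(ℝ, Cn n) η x₀ y ![v, w] = η ((extChartAt 𝓘(ℝ, Cn n) x₀).symm y)
      ![chartFrame 𝓘(ℝ, Cn n) x₀ y v, chartFrame 𝓘(ℝ, Cn n) x₀ y w] := by
  rw [formInChart, ContinuousAlternatingMap.compContinuousLinearMap_apply]
  congr 1
  ext i
  fin_cases i <;> rfl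

theorem IsKaehlerForm.isPosOneOne {η : TwoForm n X} (hη : IsKaehlerForm η) (x : X) :
    IsPosOneOne (n := n) (η x) :=
  ⟨hη.invariant x, hη.pos x⟩

variable [IsManifold 𝓘(ℂ, Cn n) ∞ X]

theorem chartFrame_bijective_of_complex {x₀ : X} {y : Cn n}
    (hy : y ∈ (extChartAt 𝓘(ℝ, Cn n) x₀).target) :
    Function.Bijective (chartFrame 𝓘(ℝ, Cn n) x₀ y : Cn n → Cn n) := by
  have := isManifold_real_of_complex (n := n) X
  have : IsManifold 𝓘(ℝ, Cn n) 1 X := .of_le (n := ∞) (by norm_cast)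
  exact chartFrame_bijective hy

theorem IsKaehlerForm.isPosOneOne_formInChart {η : TwoForm n X} (hη : IsKaehlerForm η) {x₀ : X}
    {y : Cn n} (hy : y ∈ (extChartAt 𝓘(ℝ, Cn n) x₀).target) :
    IsPosOneOne (formInChart 𝓘(ℝ, Cn n) η x₀ y) where
  invariant v w := by
    rw [formInChart_apply, formInChart_apply, chartFrame_cplxJ hy, chartFrame_cplxJ hy]
    exact hη.invariant _ _ _
  pos v hv := by
    rw [formInChart_apply, chartFrame_cplxJ hy]
    refine hη.pos _ _ fun h => hv ((chartFrame_bijective_of_complex hy).1 (h.trans ?_))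
    exact (map_zero (chartFrame 𝓘(ℝ, Cn n) x₀ y)).symm

/-- The logarithm of the quotient `η₂ⁿ / η₁ⁿ` of the volume forms of two Kähler forms. Both
determinants are taken in the preferred chart at the point; any other chart gives the same
quotient. -/
def logDetRatio (η₁ η₂ : TwoForm n X) (x : X) : ℝ :=
  Real.log (hermMatrix (n := n) (η₂ x)).det.re - Real.log (hermMatrix (n := n) (η₁ x)).det.re

/-- Under a holomorphic change of coordinates all volume densities scale by the same factor `D`. -/
theorem exists_det_hermMatrix_formInChart {x₀ : X} {y : Cn n}
    (hy : y ∈ (extChartAt 𝓘(ℝ, Cn n) x₀).target) :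
    ∃ D : ℝ, ∀ η : TwoForm n X, IsKaehlerForm η →
      (hermMatrix (formInChart 𝓘(ℝ, Cn n) η x₀ y)).det.re =
        D * (hermMatrix (n := n) (η ((extChartAt 𝓘(ℝ, Cn n) x₀).symm y))).det.re := by
  set x := (extChartAt 𝓘(ℝ, Cn n) x₀).symm y
  let e : Fin n → Cn n := fun j =>
    chartFrame 𝓘(ℝ, Cn n) x₀ y (EuclideanSpace.single j (1 : ℂ) : Cn n)
  refine ⟨Complex.normSq (Matrix.of fun i j => star (e j i)).det, fun η hη => ?_⟩
  have h : hermMatrix (formInChart 𝓘(ℝ, Cn n) η x₀ y) =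
      Matrix.of fun j k => hermForm (n := n) (η x) (e j) (e k) := by
    ext j k
    rw [hermMatrix, Matrix.of_apply, Matrix.of_apply, formInChart_apply, formInChart_apply,
      chartFrame_cplxJ hy]
    rfl
  rw [h, (hη.isPosOneOne x).det_of_hermForm e, Complex.re_ofReal_mul]

theorem logDetRatio_symm {η₁ η₂ : TwoForm n X} (h₁ : IsKaehlerForm η₁) (h₂ : IsKaehlerForm η₂)
    {x₀ : X} {y : Cn n} (hy : y ∈ (extChartAt 𝓘(ℝ, Cn n) x₀).target) :
    logDetRatio η₁ η₂ ((extChartAt 𝓘(ℝ, Cn n) x₀).symm y) =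
      Real.log (hermMatrix (formInChart 𝓘(ℝ, Cn n) η₂ x₀ y)).det.re -
        Real.log (hermMatrix (formInChart 𝓘(ℝ, Cn n) η₁ x₀ y)).det.re := by
  have p₁ := (h₁.isPosOneOne_formInChart hy).det_hermMatrix_pos
  have p₁' := (h₁.isPosOneOne ((extChartAt 𝓘(ℝ, Cn n) x₀).symm y)).det_hermMatrix_pos
  have p₂' := (h₂.isPosOneOne ((extChartAt 𝓘(ℝ, Cn n) x₀).symm y)).det_hermMatrix_pos
  obtain ⟨D, hDet⟩ := exists_det_hermMatrix_formInChart hy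
  rw [hDet η₁ h₁] at p₁ ⊢
  have hD := (pos_iff_pos_of_mul_pos p₁).2 p₁'
  rw [hDet η₂ h₂, Real.log_mul hD.ne' p₁'.ne', Real.log_mul hD.ne' p₂'.ne',
    logDetRatio]
  ring

theorem contDiffOn_log_det {η : TwoForm n X} (hη : IsKaehlerForm η) (x₀ : X) :
    ContDiffOn ℝ ∞ (fun y => Real.log (hermMatrix (formInChart 𝓘(ℝ, Cn n) η x₀ y)).det.re)
      (extChartAt 𝓘(ℝ, Cn n) x₀).target := by
  have happ (v : Fin 2 → Cn n) : ContDiffOn ℝ ∞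
      (fun y => ((formInChart 𝓘(ℝ, Cn n) η x₀ y v : ℝ) : ℂ)) (extChartAt 𝓘(ℝ, Cn n) x₀).target :=
    (Complex.ofRealCLM.contDiff.comp
      (ContinuousAlternatingMap.apply ℝ (Cn n) ℝ v).contDiff).comp_contDiffOn (hη.smooth x₀)
  have hdet : ContDiffOn ℝ ∞ (fun y => (hermMatrix (formInChart 𝓘(ℝ, Cn n) η x₀ y)).det)
      (extChartAt 𝓘(ℝ, Cn n) x₀).target := by
    simp only [Matrix.det_apply]
    refine ContDiffOn.sum fun σ _ => ContDiffOn.const_smul _ (contDiffOn_prod fun i _ => ?_)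
    exact (happ _).sub (contDiffOn_const.mul (happ _))
  exact (Complex.reCLM.contDiff.comp_contDiffOn hdet).log fun y hy =>
    (hη.isPosOneOne_formInChart hy).det_hermMatrix_pos.ne'

end Charts

/-! ### The maximum principle on a complex manifold -/

section GlobalMaximumPrinciple

/-- A function that tends to zero at infinity and satisfies the strong maximum and minimum
principles is constant on connected components: if it is not zero on a component, its maximum or its
minimum there is attained, on a set that is open and closed. -/
theorem eq_of_mem_connectedComponent {X : Type*} [TopologicalSpace X] [LocallyConnectedSpace X]
    {f : X → ℝ} (hf : Continuous f) (hc : ∀ ε : ℝ, 0 < ε → IsCompact {x | ε ≤ |f x|})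
    (hmax : ∀ x, IsLocalMax f x → ∀ᶠ z in 𝓝 x, f z = f x)
    (hmin : ∀ x, IsLocalMin f x → ∀ᶠ z in 𝓝 x, f z = f x) {x z : X}
    (hz : z ∈ connectedComponent x) : f z = f x := by
  -- the case of a positive value; the general case follows by changing the sign
  have pos_case : ∀ g : X → ℝ, Continuous g → (∀ ε : ℝ, 0 < ε → IsCompact {x | ε ≤ |g x|}) →
      (∀ x, IsLocalMax g x → ∀ᶠ z in 𝓝 x, g z = g x) → ∀ y, 0 < g y →
      ∀ z ∈ connectedComponent y, g z = g y := by
    intro g hg hgc hgmax y hy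
    set C := connectedComponent y with hC
    have hCo : IsOpen C := isOpen_connectedComponent
    have hK : IsCompact ({x | g y ≤ |g x|} ∩ C) :=
      (hgc _ hy).inter_right isClosed_connectedComponent
    obtain ⟨p, ⟨-, hpC⟩, hp⟩ := hK.exists_isMaxOn ⟨y, le_abs_self (g y), mem_connectedComponent⟩
      hg.continuousOn
    have hpmax : ∀ w ∈ C, g w ≤ g p := by
      intro w hw
      by_cases h : g y ≤ g w
      · exact hp ⟨h.trans (le_abs_self _), hw⟩
      · exact (not_le.1 h).le.trans (hp ⟨le_abs_self (g y), mem_connectedComponent⟩)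
    set M : Set X := C ∩ g ⁻¹' {g p} with hM
    have hMo : IsOpen M := by
      rw [isOpen_iff_mem_nhds]
      rintro w ⟨hwC, hw⟩
      have hw' : g w = g p := hw
      have hlm : IsLocalMax g w := by
        filter_upwards [hCo.mem_nhds hwC] with v hv
        rw [hw']; exact hpmax v hv
      filter_upwards [hCo.mem_nhds hwC, hgmax w hlm] with v hv hv'
      exact ⟨hv, hv'.trans hw⟩
    have hMc : IsClosed M := isClosed_connectedComponent.inter (isClosed_singleton.preimage hg)
    have hsub : C ⊆ M := isPreconnected_connectedComponent.subset_isClopen ⟨hMc, hMo⟩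
      ⟨p, hpC, hpC, rfl⟩
    intro z hz
    have h1 : g z = g p := (hsub hz).2
    have h2 : g y = g p := (hsub mem_connectedComponent).2
    rw [h1, h2]
  have hpos := pos_case f hf hc hmax
  have hneg := pos_case (fun x => -f x) hf.neg (by simpa only [abs_neg] using hc) (fun x hx => by
    have : IsLocalMin f x := by simpa using hx.neg
    filter_upwards [hmin x this] with z hz
    rw [hz])
  by_cases h0 : f z = 0 ∧ f x = 0
  · rw [h0.1, h0.2]
  · have hzx : connectedComponent x = connectedComponent z := connectedComponent_eq hz
    have hx : x ∈ connectedComponent z := hzx ▸ mem_connectedComponent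
    rcases lt_trichotomy (f x) 0 with h | h | h
    · exact neg_injective (hneg x (neg_pos.2 h) z hz)
    · rcases lt_trichotomy (f z) 0 with h' | h' | h'
      · exact (neg_injective (hneg z (neg_pos.2 h') x hx)).symm
      · exact absurd ⟨h', h⟩ h0
      · exact (hpos z h' x hx).symm
    · exact hpos x h z hz

variable {n : ℕ} {X : Type*} [TopologicalSpace X] [ChartedSpace (Cn n) X]

theorem isLocalMax_comp_extChartAt_symm {f : X → ℝ} {x : X} (h : IsLocalMax f x) :
    IsLocalMax (fun y => f ((extChartAt 𝓘(ℝ, Cn n) x).symm y)) (extChartAt 𝓘(ℝ, Cn n) x x) := by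
  have h' : IsLocalMax f ((extChartAt 𝓘(ℝ, Cn n) x).symm (extChartAt 𝓘(ℝ, Cn n) x x)) := by
    rwa [extChartAt_to_inv]
  exact h'.comp_continuous (continuousAt_extChartAt_symm x)

theorem eventually_eq_of_isLocalMax_of_sum_iddbar_nonneg {f : X → ℝ} {x : X}
    (hf : ContDiffOn ℝ 2 (fun y => f ((extChartAt 𝓘(ℝ, Cn n) x).symm y))
      (extChartAt 𝓘(ℝ, Cn n) x).target) {c C : ℝ} (hc : 0 < c)
    (hell : ∀ᶠ y in 𝓝 (extChartAt 𝓘(ℝ, Cn n) x x), ∃ e : Fin n → Cn n, (∀ i, ‖e i‖ ≤ C) ∧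
      (∀ ξ : Cn n, c * ‖ξ‖ ^ 2 ≤ ∑ i, ‖inner ℂ ξ (e i)‖ ^ 2) ∧
      0 ≤ ∑ i, (iddbar (fun y => f ((extChartAt 𝓘(ℝ, Cn n) x).symm y)) y
        ![e i, cplxJ n (e i)]).re)
    (hmax : IsLocalMax f x) : ∀ᶠ z in 𝓝 x, f z = f x := by
  have htarget := extChartAt_target_mem_nhds (I := 𝓘(ℝ, Cn n)) x
  obtain ⟨U, hU, hUo, hxU⟩ := eventually_nhds_iff.1
    (hell.and ((isLocalMax_comp_extChartAt_symm hmax).and htarget))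
  have key := eventually_eq_of_isMaxOn_of_sum_iddbar_nonneg hUo hxU
    (hf.mono fun y hy => (hU y hy).2.2) hc (fun y hy => (hU y hy).1) fun y hy => (hU y hy).2.1
  filter_upwards [(continuousAt_extChartAt (I := 𝓘(ℝ, Cn n)) x).eventually key,
    extChartAt_source_mem_nhds (I := 𝓘(ℝ, Cn n)) x] with z hz hzs
  rwa [(extChartAt 𝓘(ℝ, Cn n) x).left_inv hzs, extChartAt_to_inv] at hz

theorem eventually_eq_of_isLocalMax_of_iddbar_eq_zero {f : X → ℝ} {x : X}
    (hf : ContDiffOn ℝ 2 (fun y => f ((extChartAt 𝓘(ℝ, Cn n) x).symm y))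
      (extChartAt 𝓘(ℝ, Cn n) x).target)
    (hpl : ∀ y ∈ (extChartAt 𝓘(ℝ, Cn n) x).target, ∀ v,
      iddbar (fun y => f ((extChartAt 𝓘(ℝ, Cn n) x).symm y)) y ![v, cplxJ n v] = 0)
    (hmax : IsLocalMax f x) : ∀ᶠ z in 𝓝 x, f z = f x := by
  refine eventually_eq_of_isLocalMax_of_sum_iddbar_nonneg hf (c := 1) (C := 1) one_pos ?_ hmax
  filter_upwards [extChartAt_target_mem_nhds (I := 𝓘(ℝ, Cn n)) x] with y hy
  refine ⟨fun i => EuclideanSpace.single i 1, fun i => by simp, fun ξ => ?_, ?_⟩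
  · rw [one_mul, EuclideanSpace.norm_sq_eq]
    refine le_of_eq (Finset.sum_congr rfl fun i _ => ?_)
    simp [EuclideanSpace.inner_single_right]
  · simp only [hpl y hy, Complex.zero_re, Finset.sum_const_zero, le_refl]

variable [IsManifold 𝓘(ℂ, Cn n) ∞ X]

theorem contDiffOn_comp_extChartAt_symm {u : X → ℝ} (hu : ContMDiff 𝓘(ℝ, Cn n) 𝓘(ℝ, ℝ) 2 u)
    (x₀ : X) : ContDiffOn ℝ 2 (fun y => u ((extChartAt 𝓘(ℝ, Cn n) x₀).symm y))
      (extChartAt 𝓘(ℝ, Cn n) x₀).target := by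
  have := isManifold_real_of_complex (n := n) X
  have : IsManifold 𝓘(ℝ, Cn n) 2 X := .of_le (n := ∞) (by norm_cast)
  rw [← contMDiffOn_iff_contDiffOn]
  exact hu.comp_contMDiffOn (contMDiffOn_extChartAt_symm x₀)

/-- The strong maximum principle for the potential `u` of `η₂ = η₁ + i∂∂̄u`, when `η₁` and `η₂` have
the same volume form: `u` is then subharmonic for `η₁`. -/
theorem eventually_eq_of_isLocalMax_of_logDetRatio_eq_zero {η₁ η₂ : TwoForm n X}
    (h₁ : IsKaehlerForm η₁) (h₂ : IsKaehlerForm η₂) (hdet : ∀ x, logDetRatio η₁ η₂ x = 0)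
    {u : X → ℝ} {x : X}
    (hu : ContDiffOn ℝ 2 (fun y => u ((extChartAt 𝓘(ℝ, Cn n) x).symm y))
      (extChartAt 𝓘(ℝ, Cn n) x).target)
    (hη : ∀ y ∈ (extChartAt 𝓘(ℝ, Cn n) x).target, ∀ v,
      (iddbar (fun y => u ((extChartAt 𝓘(ℝ, Cn n) x).symm y)) y ![v, cplxJ n v]).re =
        formInChart 𝓘(ℝ, Cn n) η₂ x y ![v, cplxJ n v] -
          formInChart 𝓘(ℝ, Cn n) η₁ x y ![v, cplxJ n v])
    (hmax : IsLocalMax u x) : ∀ᶠ z in 𝓝 x, u z = u x := by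
  set θ := formInChart 𝓘(ℝ, Cn n) η₁ x with hθ
  set y₀ := extChartAt 𝓘(ℝ, Cn n) x x with hy₀
  have hy₀t : y₀ ∈ (extChartAt 𝓘(ℝ, Cn n) x).target := mem_extChartAt_target x
  have htarget := extChartAt_target_mem_nhds (I := 𝓘(ℝ, Cn n)) x
  obtain ⟨c, hc, hcθ⟩ := (h₁.isPosOneOne_formInChart hy₀t).exists_lower_bound
  have hcont : ContinuousAt θ y₀ := (h₁.smooth x).continuousOn.continuousAt htarget
  -- near `y₀` the form is uniformly comparable with the Euclidean metric
  set M := ‖θ y₀‖ + c / 2 with hM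
  have hMpos : 0 < M := by positivity
  refine eventually_eq_of_isLocalMax_of_sum_iddbar_nonneg hu (c := M⁻¹) (C := √(2 / c))
    (inv_pos.2 hMpos) ?_ hmax
  filter_upwards [htarget, Metric.continuousAt_iff'.1 hcont (c / 2) (half_pos hc)] with y hy hyd
  rw [dist_eq_norm] at hyd
  have hdiff (v : Cn n) : |θ y ![v, cplxJ n v] - θ y₀ ![v, cplxJ n v]| ≤ c / 2 * ‖v‖ ^ 2 :=
    (abs_twoForm_cplxJ_le (θ y - θ y₀) v).trans (by gcongr)
  have p₁ := h₁.isPosOneOne_formInChart hy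
  have p₂ := h₂.isPosOneOne_formInChart hy
  obtain ⟨e, l, D, hD, horth, he₁, he₂, hl, hD₁, hD₂⟩ := exists_adapted_frame p₁ p₂
  refine ⟨e, fun i => ?_, fun ξ => ?_, ?_⟩
  · have h3 := abs_le.1 (hdiff (e i))
    have h4 := hcθ (e i)
    rw [he₁ i] at h3
    refine Real.le_sqrt_of_sq_le ?_
    rw [le_div_iff₀ hc]
    linarith
  · refine norm_sq_le_of_hermForm_orthonormal p₁ horth hMpos (fun v => ?_) ξ
    have h3 := abs_le.1 (hdiff v)
    have h4 := abs_le.1 (abs_twoForm_cplxJ_le (θ y₀) v)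
    rw [hM, add_mul]
    linarith
  · have hprod : ∏ i, l i = 1 := by
      have h3 := hdet ((extChartAt 𝓘(ℝ, Cn n) x).symm y)
      rw [logDetRatio_symm h₁ h₂ hy, sub_eq_zero] at h3
      rw [← hD₂, Real.log_injOn_pos p₂.det_hermMatrix_pos p₁.det_hermMatrix_pos h3, hD₁]
    refine (sum_sub_one_nonneg_of_prod_eq_one hl hprod).trans_eq
      (Finset.sum_congr rfl fun i _ => ?_)
    rw [hη y hy, he₂, he₁]

/-- At a maximum of `u` the form `i∂∂̄u` is nonpositive, so `η₂ ≤ η₁`. -/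
theorem logDetRatio_nonpos_of_isLocalMax {η₁ η₂ : TwoForm n X}
    (h₁ : IsKaehlerForm η₁) (h₂ : IsKaehlerForm η₂) {u : X → ℝ} {x : X}
    (hu : ContDiffOn ℝ 2 (fun y => u ((extChartAt 𝓘(ℝ, Cn n) x).symm y))
      (extChartAt 𝓘(ℝ, Cn n) x).target)
    (hη : ∀ y ∈ (extChartAt 𝓘(ℝ, Cn n) x).target, ∀ v,
      (iddbar (fun y => u ((extChartAt 𝓘(ℝ, Cn n) x).symm y)) y ![v, cplxJ n v]).re =
        formInChart 𝓘(ℝ, Cn n) η₂ x y ![v, cplxJ n v] -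
          formInChart 𝓘(ℝ, Cn n) η₁ x y ![v, cplxJ n v])
    (hmax : IsLocalMax u x) : logDetRatio η₁ η₂ x ≤ 0 := by
  have hy := mem_extChartAt_target (I := 𝓘(ℝ, Cn n)) x
  have p₁ := h₁.isPosOneOne_formInChart hy
  have p₂ := h₂.isPosOneOne_formInChart hy
  have h := logDetRatio_symm h₁ h₂ hy
  rw [extChartAt_to_inv] at h
  rw [h, sub_nonpos]
  refine Real.log_le_log p₂.det_hermMatrix_pos ?_
  have := det_le_of_forall_le p₁ p₂ (a := 1) fun v => ?_
  · simpa using this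
  · have h3 := iddbar_re_nonpos_of_isLocalMax
      (hu.contDiffAt (extChartAt_target_mem_nhds (I := 𝓘(ℝ, Cn n)) x))
      (isLocalMax_comp_extChartAt_symm hmax) v
    rw [hη _ hy] at h3
    linarith

end GlobalMaximumPrinciple

/-! ### Decay along the conical end -/

section Decay

section Ck

variable {V : Type*} [NormedAddCommGroup V] [NormedSpace ℝ V]
  {H : Type*} [TopologicalSpace H] {I : ModelWithCorners ℝ V H} [I.Boundaryless]
  {N : Type*} [TopologicalSpace N] [ChartedSpace H N] [IsManifold I 1 N]

/-- A finite `C^k`-norm bounds the tensor itself, by the term of order zero. -/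
theorem exists_bound_of_ckNorm_lt_top
    {g : ∀ p : N, TangentSpace I p →L[ℝ] TangentSpace I p →L[ℝ] ℝ} {A : Set N} {k m : ℕ}
    {T : ∀ p : N, (Fin m → TangentSpace I p) → ℝ} (h : ckNorm I g A k T < ⊤) :
    ∃ C : ℝ, ∀ p ∈ A, ∀ w : Fin m → TangentSpace I p, (∀ j, g p (w j) (w j) ≤ 1) → |T p w| ≤ C := by
  refine ⟨(ckNorm I g A k T).toReal, fun p hp => ?_⟩
  have key : ∀ w : Fin m → TangentSpace I ((extChartAt I p).symm (extChartAt I p p)),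
      (∀ j, g ((extChartAt I p).symm (extChartAt I p p)) (w j) (w j) ≤ 1) →
      |T ((extChartAt I p).symm (extChartAt I p p)) w| ≤ (ckNorm I g A k T).toReal := by
    intro w hw
    choose v hv using fun j =>
      (chartFrame_bijective (I := I) (mem_extChartAt_target (I := I) p)).2 (w j)
    have h1 : ENNReal.ofReal |T ((extChartAt I p).symm (extChartAt I p p)) w| ≤
        tensorNorm (bilinInChart I g p (extChartAt I p p))
          (tensorInChart I T p (extChartAt I p p)) := by
      have hT : tensorInChart I T p (extChartAt I p p) v =
          T ((extChartAt I p).symm (extChartAt I p p)) w :=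
        congrArg (T ((extChartAt I p).symm (extChartAt I p p))) (funext hv)
      rw [← hT]
      refine le_iSup₂_of_le v (fun j => ?_) le_rfl
      have h2 := hw j
      rw [← hv j] at h2
      exact h2
    have h2 : tensorNorm (bilinInChart I g p (extChartAt I p p))
        (tensorInChart I T p (extChartAt I p p)) ≤ ckNorm I g A k T := by
      refine le_trans ?_ (Finset.single_le_sum_of_canonicallyOrdered
        (Finset.mem_range.2 (Nat.succ_pos k)))
      exact le_iSup₂_of_le p hp le_rfl
    exact (ENNReal.ofReal_le_iff_le_toReal h.ne).1 (h1.trans h2)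
  exact (extChartAt_to_inv (I := I) p) ▸ key

end Ck

variable {n : ℕ} {S : Type*} [TopologicalSpace S] [ChartedSpace (LinkModel n) S]
  {X : Type*} [TopologicalSpace X] [ChartedSpace (Cn n) X]

theorem CylindricalBoundary.isCompact_le_abs (B : CylindricalBoundary n X S) {f : X → ℝ}
    (hf : Continuous f) {ε : ℝ} (h : ∃ T : ℝ, ∀ p : ℝ × S, T ≤ p.1 → |f (B.Φ.symm p)| < ε) :
    IsCompact {x | ε ≤ |f x|} := by
  obtain ⟨T, hT⟩ := h
  refine (B.isCompact_sublevel T).of_isClosed_subset (isClosed_le continuous_const hf.abs) ?_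
  intro x hx
  by_cases hxK : x ∈ B.K
  · exact Or.inl hxK
  · refine Or.inr ⟨hxK, ?_⟩
    by_contra! hlt
    have h1 := hT (B.Φ x) hlt.le
    rw [B.Φ.left_inv (by rw [B.source_eq]; exact hxK)] at h1
    exact absurd hx (not_le.2 h1)

theorem CylindricalBoundary.mfderiv_symm_surjective [IsManifold 𝓘(ℂ, Cn n) ∞ X]
    [IsManifold 𝓘(ℝ, LinkModel n) ∞ S] (B : CylindricalBoundary n X S) (p : ℝ × S) :
    Function.Surjective (mfderiv (cylModel n) 𝓘(ℝ, Cn n) B.Φ.symm p) := by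
  have := isManifold_real_of_complex (n := n) X
  have : IsManifold 𝓘(ℝ, Cn n) 1 X := .of_le (n := ∞) (by norm_cast)
  have hM : B.Φ.MDifferentiable 𝓘(ℝ, Cn n) (cylModel n) :=
    ⟨by rw [B.source_eq]; exact B.smooth.mdifferentiableOn (by simp),
      (B.smooth_symm.mdifferentiable (by simp)).mdifferentiableOn⟩
  exact hM.symm.mfderiv_surjective (by simp [B.target_eq])

variable [IsManifold 𝓘(ℝ, LinkModel n) ∞ S]
  (gS : Bundle.ContMDiffRiemannianMetric 𝓘(ℝ, LinkModel n) ∞ (LinkModel n)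
      (TangentSpace 𝓘(ℝ, LinkModel n) : S → Type _))

theorem cylMetric_self_pos (p : ℝ × S) {v : TangentSpace (cylModel n) p} (hv : v ≠ 0) :
    0 < cylMetric gS p v v := by
  obtain ⟨a, b⟩ : ℝ × LinkModel n := v
  have h : cylMetric gS p (a, b) (a, b) = a * a + gS.inner p.2 b b := by
    unfold cylMetric
    rw [mfderiv_fst, mfderiv_snd]
    rfl
  have hb0 : gS.inner p.2 (0 : LinkModel n) (0 : LinkModel n) = 0 := by
    exact map_zero _
  change 0 < cylMetric gS p (a, b) (a, b)
  rw [h]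
  by_cases hb : b = 0
  · have ha : a ≠ 0 := fun ha => hv (by rw [ha, hb]; rfl)
    rw [hb]
    have := mul_self_pos.2 ha
    linarith
  · have := gS.pos p.2 b hb
    nlinarith [mul_self_nonneg a]

/-- A conical metric is asymptotic to `e^{2t} g_cyl`, in the sense of quadratic forms. -/
theorem exists_abs_sub_cylMetric_le [IsManifold 𝓘(ℂ, Cn n) ∞ X] {B : CylindricalBoundary n X S}
    {η : TwoForm n X} (h : IsConical B gS η.metric) {ε : ℝ} (hε : 0 < ε) :
    ∃ T : ℝ, ∀ p : ℝ × S, T ≤ p.1 → ∀ v : TangentSpace (cylModel n) p,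
      |Real.exp (-2 * p.1) * B.pullback η.metric p v v - cylMetric gS p v v| ≤
        ε * cylMetric gS p v v := by
  obtain ⟨δ, hδ, k, -, hk⟩ := h
  have : IsManifold 𝓘(ℝ, LinkModel n) 1 S := .of_le (n := ∞) (by norm_cast)
  obtain ⟨C, hC⟩ := exists_bound_of_ckNorm_lt_top hk
  obtain ⟨T, hT⟩ := (((Real.tendsto_exp_atTop.comp
    (Filter.tendsto_id.const_mul_atTop hδ)).eventually_ge_atTop (C / ε)).and
      (Filter.eventually_ge_atTop 0)).exists_forall_of_atTop
  refine ⟨T, fun p hp v => ?_⟩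
  obtain ⟨hexp, h0⟩ := hT p.1 hp
  have hGs (s : ℝ) (v : TangentSpace (cylModel n) p) :
      cylMetric gS p (s • v) (s • v) = s ^ 2 * cylMetric gS p v v := by
    rw [map_smul, map_smul, sq, mul_assoc]; rfl
  set R : TangentSpace (cylModel n) p → ℝ := fun v =>
    Real.exp (-2 * p.1) * B.pullback η.metric p v v - cylMetric gS p v v with hR
  have hRs (s : ℝ) (v : TangentSpace (cylModel n) p) : R (s • v) = s ^ 2 * R v := by
    have h1 : B.pullback η.metric p (s • v) (s • v) = s ^ 2 * B.pullback η.metric p v v := by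
      unfold CylindricalBoundary.pullback TwoForm.metric
      rw [map_smul]
      exact twoForm_smul_cplxJ_smul (n := n) (η (B.Φ.symm p)) s _
    simp only [hR, h1, hGs]; ring
  change |R v| ≤ _
  by_cases hv : v = 0
  · have hz : cylMetric gS p v v = 0 := by rw [hv, map_zero]
    have hRz : R v = 0 := by
      have := hRs 0 v
      rw [zero_smul] at this
      rw [hv, this]; ring
    rw [hz, hRz]; simp
  · have hpos := cylMetric_self_pos gS p hv
    set G := cylMetric gS p v v with hG
    set s := (√G)⁻¹ with hs
    have hs2 : s ^ 2 = G⁻¹ := by rw [hs, inv_pow, Real.sq_sqrt hpos.le]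
    have hb := hC p h0 (fun _ => s • v) fun _ => by
      rw [hGs, ← hG, hs2, inv_mul_cancel₀ hpos.ne']
    change |Real.exp (δ * p.1) * R (s • v)| ≤ C at hb
    rw [hRs, hs2, abs_mul, abs_mul, abs_of_pos (Real.exp_pos _), abs_of_pos (inv_pos.2 hpos)] at hb
    have hexp' : C ≤ ε * Real.exp (δ * p.1) := by
      have : C / ε ≤ Real.exp (δ * p.1) := hexp
      rwa [div_le_iff₀' hε] at this
    have h3 : Real.exp (δ * p.1) * (G⁻¹ * |R v|) ≤ Real.exp (δ * p.1) * ε := by linarith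
    have h4 := le_of_mul_le_mul_left h3 (Real.exp_pos _)
    rwa [inv_mul_le_iff₀ hpos, mul_comm] at h4

theorem exists_forall_le_mul_of_isConical [IsManifold 𝓘(ℂ, Cn n) ∞ X]
    {B : CylindricalBoundary n X S} {η₁ η₂ : TwoForm n X} (h₁ : IsConical B gS η₁.metric)
    (h₂ : IsConical B gS η₂.metric) {a : ℝ} (ha : 1 < a) :
    ∃ T : ℝ, ∀ p : ℝ × S, T ≤ p.1 → ∀ w : TangentSpace 𝓘(ℝ, Cn n) (B.Φ.symm p),
      η₂ (B.Φ.symm p) ![w, tangentJ _ w] ≤ a * η₁ (B.Φ.symm p) ![w, tangentJ _ w] := by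
  -- chosen so that `(1 + ε) / (1 - ε) = a`
  set ε := (a - 1) / (a + 1) with hε
  have hεpos : 0 < ε := div_pos (by linarith) (by linarith)
  obtain ⟨T₁, hT₁⟩ := exists_abs_sub_cylMetric_le gS h₁ hεpos
  obtain ⟨T₂, hT₂⟩ := exists_abs_sub_cylMetric_le gS h₂ hεpos
  refine ⟨max T₁ T₂, fun p hp w => ?_⟩
  obtain ⟨v, rfl⟩ := B.mfderiv_symm_surjective p w
  have b₁ := abs_le.1 (hT₁ p ((le_max_left _ _).trans hp) v)
  have b₂ := abs_le.1 (hT₂ p ((le_max_right _ _).trans hp) v)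
  change B.pullback η₂.metric p v v ≤ a * B.pullback η₁.metric p v v
  have hε' : 1 + ε = a * (1 - ε) := by
    have : a + 1 ≠ 0 := by linarith
    rw [hε]; field_simp; ring
  have hexp := Real.exp_pos (-2 * p.1)
  refine le_of_mul_le_mul_left ?_ hexp
  set G := cylMetric gS p v v
  have h3 : Real.exp (-2 * p.1) * B.pullback η₂.metric p v v ≤ (1 + ε) * G := by linarith
  have h4 : (1 - ε) * G ≤ Real.exp (-2 * p.1) * B.pullback η₁.metric p v v := by linarith
  calc Real.exp (-2 * p.1) * B.pullback η₂.metric p v v ≤ (1 + ε) * G := h3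
    _ = a * ((1 - ε) * G) := by rw [hε']; ring
    _ ≤ a * (Real.exp (-2 * p.1) * B.pullback η₁.metric p v v) := by gcongr
    _ = Real.exp (-2 * p.1) * (a * B.pullback η₁.metric p v v) := by ring

theorem exists_logDetRatio_lt [IsManifold 𝓘(ℂ, Cn n) ∞ X]
    {B : CylindricalBoundary n X S} {η₁ η₂ : TwoForm n X} (k₁ : IsKaehlerForm η₁)
    (k₂ : IsKaehlerForm η₂) (h₁ : IsConical B gS η₁.metric)
    (h₂ : IsConical B gS η₂.metric) {ε : ℝ} (hε : 0 < ε) :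
    ∃ T : ℝ, ∀ p : ℝ × S, T ≤ p.1 → logDetRatio η₁ η₂ (B.Φ.symm p) < ε := by
  have hn : (0 : ℝ) < n + 1 := by positivity
  obtain ⟨T, hT⟩ := exists_forall_le_mul_of_isConical gS h₁ h₂
    (a := Real.exp (ε / (n + 1))) (Real.one_lt_exp_iff.2 (div_pos hε hn))
  refine ⟨T, fun p hp => ?_⟩
  have p₁ := k₁.isPosOneOne (B.Φ.symm p)
  have p₂ := k₂.isPosOneOne (B.Φ.symm p)
  have h := Real.log_le_log p₂.det_hermMatrix_pos (det_le_of_forall_le p₁ p₂ (hT p hp))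
  rw [Real.log_mul (by positivity) p₁.det_hermMatrix_pos.ne', Real.log_pow, Real.log_exp] at h
  have h2 : n * (ε / (n + 1)) < ε := by
    rw [mul_div_assoc', div_lt_iff₀ hn]
    linarith
  rw [logDetRatio]
  linarith

theorem exists_abs_lt_of_weightedCkNorm_lt_top {B : CylindricalBoundary n X S} {δ : ℝ} (hδ : 0 < δ)
    {k : ℕ} {u : X → ℝ} (hu : weightedCkNorm B gS δ k u < ⊤) {ε : ℝ} (hε : 0 < ε) :
    ∃ T : ℝ, ∀ p : ℝ × S, T ≤ p.1 → |u (B.Φ.symm p)| < ε := by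
  have : IsManifold 𝓘(ℝ, LinkModel n) 1 S := .of_le (n := ∞) (by norm_cast)
  obtain ⟨C, hC⟩ := exists_bound_of_ckNorm_lt_top hu
  obtain ⟨T, hT⟩ := (((Real.tendsto_exp_atTop.comp
    (Filter.tendsto_id.const_mul_atTop hδ)).eventually_gt_atTop (C / ε)).and
      (Filter.eventually_ge_atTop 0)).exists_forall_of_atTop
  refine ⟨T, fun p hp => ?_⟩
  obtain ⟨hexp, h0⟩ := hT p.1 hp
  have hb : |Real.exp (δ * p.1) * u (B.Φ.symm p)| ≤ C := hC p h0 Fin.elim0 fun j => j.elim0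
  rw [abs_mul, abs_of_pos (Real.exp_pos _)] at hb
  have hexp' : C < ε * Real.exp (δ * p.1) := by
    have : C / ε < Real.exp (δ * p.1) := hexp
    rwa [div_lt_iff₀' hε] at this
  refine lt_of_mul_lt_mul_left (a := Real.exp (δ * p.1)) ?_ (Real.exp_pos _).le
  linarith

end Decay

/-! ### Uniqueness of the Ricci-flat form -/

section Uniqueness

variable {n : ℕ} {X : Type*} [TopologicalSpace X] [ChartedSpace (Cn n) X]
  {η₁ η₂ : TwoForm n X} {u : X → ℝ}

theorem EqAddIddbar.re_iddbar (h : EqAddIddbar η₂ η₁ u) (x₀ : X) {y : Cn n}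
    (hy : y ∈ (extChartAt 𝓘(ℝ, Cn n) x₀).target) (v : Cn n) :
    (iddbar (fun y => u ((extChartAt 𝓘(ℝ, Cn n) x₀).symm y)) y ![v, cplxJ n v]).re =
      formInChart 𝓘(ℝ, Cn n) η₂ x₀ y ![v, cplxJ n v] -
        formInChart 𝓘(ℝ, Cn n) η₁ x₀ y ![v, cplxJ n v] := by
  have := congrArg Complex.re (h x₀ y hy ![v, cplxJ n v])
  simp only [Complex.add_re, Complex.ofReal_re] at this
  linarith

theorem logDetRatio_swap (η₁ η₂ : TwoForm n X) (x : X) :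
    logDetRatio η₂ η₁ x = -logDetRatio η₁ η₂ x := by
  simp [logDetRatio]

variable [IsManifold 𝓘(ℂ, Cn n) ∞ X]

theorem EqAddIddbar.re_iddbar_neg (h : EqAddIddbar η₂ η₁ u)
    (hu : ContMDiff 𝓘(ℝ, Cn n) 𝓘(ℝ, ℝ) 2 u) (x₀ : X) {y : Cn n}
    (hy : y ∈ (extChartAt 𝓘(ℝ, Cn n) x₀).target) (v : Cn n) :
    (iddbar (fun y => -u ((extChartAt 𝓘(ℝ, Cn n) x₀).symm y)) y ![v, cplxJ n v]).re =
      formInChart 𝓘(ℝ, Cn n) η₁ x₀ y ![v, cplxJ n v] -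
        formInChart 𝓘(ℝ, Cn n) η₂ x₀ y ![v, cplxJ n v] := by
  have hC := (contDiffOn_comp_extChartAt_symm hu x₀).contDiffAt
    ((isOpen_extChartAt_target x₀).mem_nhds hy)
  rw [iddbar_neg_apply_cplxJ hC, Complex.neg_re, h.re_iddbar x₀ hy]
  ring

theorem contDiffOn_logDetRatio (h₁ : IsKaehlerForm η₁) (h₂ : IsKaehlerForm η₂) (x₀ : X) :
    ContDiffOn ℝ ∞ (fun y => logDetRatio η₁ η₂ ((extChartAt 𝓘(ℝ, Cn n) x₀).symm y))
      (extChartAt 𝓘(ℝ, Cn n) x₀).target :=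
  ((contDiffOn_log_det h₂ x₀).sub (contDiffOn_log_det h₁ x₀)).congr fun _ hy =>
    logDetRatio_symm h₁ h₂ hy

theorem continuous_logDetRatio (h₁ : IsKaehlerForm η₁) (h₂ : IsKaehlerForm η₂) :
    Continuous (logDetRatio η₁ η₂) := by
  refine continuous_iff_continuousAt.2 fun x => ?_
  have h := ((contDiffOn_logDetRatio h₁ h₂ x).continuousOn.continuousAt
    (extChartAt_target_mem_nhds (I := 𝓘(ℝ, Cn n)) x)).comp
      (continuousAt_extChartAt (I := 𝓘(ℝ, Cn n)) x)
  refine h.congr ?_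
  filter_upwards [extChartAt_source_mem_nhds (I := 𝓘(ℝ, Cn n)) x] with z hz
  simp only [Function.comp_apply, (extChartAt 𝓘(ℝ, Cn n) x).left_inv hz]

theorem eventually_logDetRatio_eq_of_isLocalMax (h₁ : IsKaehlerForm η₁) (h₂ : IsKaehlerForm η₂)
    (r₁ : IsRicciFlat η₁) (r₂ : IsRicciFlat η₂) {x : X}
    (hmax : IsLocalMax (logDetRatio η₁ η₂) x) :
    ∀ᶠ z in 𝓝 x, logDetRatio η₁ η₂ z = logDetRatio η₁ η₂ x := by
  refine eventually_eq_of_isLocalMax_of_iddbar_eq_zero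
    ((contDiffOn_logDetRatio h₁ h₂ x).of_le (by norm_cast)) (fun y hy v => ?_) hmax
  have ht := (isOpen_extChartAt_target (I := 𝓘(ℝ, Cn n)) x).mem_nhds hy
  have hc {η : TwoForm n X} (hη : IsKaehlerForm η) : ContDiffAt ℝ 2
      (fun y => Real.log (hermMatrix (formInChart 𝓘(ℝ, Cn n) η x y)).det.re) y :=
    ((contDiffOn_log_det hη x).contDiffAt ht).of_le (by norm_cast)
  have h := iddbar_congr (Filter.eventuallyEq_of_mem ht fun z hz => logDetRatio_symm h₁ h₂ hz)
  rw [h, iddbar_sub_apply_cplxJ (hc h₂) (hc h₁)]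
  have e₁ := r₁ x y hy
  have e₂ := r₂ x y hy
  rw [ricciForm, neg_eq_zero] at e₁ e₂
  rw [e₁, e₂]
  simp

variable {S : Type*} [TopologicalSpace S] [ChartedSpace (LinkModel n) S]
  [IsManifold 𝓘(ℝ, LinkModel n) ∞ S]
  {gS : Bundle.ContMDiffRiemannianMetric 𝓘(ℝ, LinkModel n) ∞ (LinkModel n)
      (TangentSpace 𝓘(ℝ, LinkModel n) : S → Type _)} {B : CylindricalBoundary n X S}

theorem isCompact_le_abs_logDetRatio (h₁ : IsRicciFlatConicalKaehler B gS η₁)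
    (h₂ : IsRicciFlatConicalKaehler B gS η₂) {ε : ℝ} (hε : 0 < ε) :
    IsCompact {x | ε ≤ |logDetRatio η₁ η₂ x|} := by
  refine B.isCompact_le_abs (continuous_logDetRatio h₁.kaehler h₂.kaehler) ?_
  obtain ⟨T, hT⟩ := exists_logDetRatio_lt gS h₁.kaehler h₂.kaehler h₁.conical h₂.conical hε
  obtain ⟨T', hT'⟩ := exists_logDetRatio_lt gS h₂.kaehler h₁.kaehler h₂.conical h₁.conical hε
  refine ⟨max T T', fun p hp => abs_lt.2 ⟨?_, hT p ((le_max_left _ _).trans hp)⟩⟩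
  have := hT' p ((le_max_right _ _).trans hp)
  rw [logDetRatio_swap] at this
  linarith

/-- Two Ricci-flat conical Kähler forms that differ by `i∂∂̄u` have the same volume form. -/
theorem logDetRatio_eq_zero (h₁ : IsRicciFlatConicalKaehler B gS η₁)
    (h₂ : IsRicciFlatConicalKaehler B gS η₂) (hu : ContMDiff 𝓘(ℝ, Cn n) 𝓘(ℝ, ℝ) 2 u)
    (hη : EqAddIddbar η₂ η₁ u) (x : X) : logDetRatio η₁ η₂ x = 0 := by
  have : LocallyConnectedSpace X := ChartedSpace.locallyConnectedSpace (Cn n) X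
  have hconst (z : X) (hz : z ∈ connectedComponent x) :
      logDetRatio η₁ η₂ z = logDetRatio η₁ η₂ x := by
    refine eq_of_mem_connectedComponent (continuous_logDetRatio h₁.kaehler h₂.kaehler)
      (fun ε hε => isCompact_le_abs_logDetRatio h₁ h₂ hε) (fun y hy =>
        eventually_logDetRatio_eq_of_isLocalMax h₁.kaehler h₂.kaehler h₁.ricciFlat h₂.ricciFlat hy)
      (fun y hy => ?_) hz
    have hy' : IsLocalMax (logDetRatio η₂ η₁) y := by
      have : logDetRatio η₂ η₁ = fun z => -logDetRatio η₁ η₂ z := funext (logDetRatio_swap η₁ η₂)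
      rw [this]
      exact hy.neg
    filter_upwards [eventually_logDetRatio_eq_of_isLocalMax h₂.kaehler h₁.kaehler h₂.ricciFlat
      h₁.ricciFlat hy'] with z hz
    rwa [logDetRatio_swap η₁ η₂, logDetRatio_swap η₁ η₂, neg_inj] at hz
  by_contra hne
  -- a nonzero constant can only occur on a compact component, where `u` has a maximum and a minimum
  have hK : IsCompact (connectedComponent x) :=
    (isCompact_le_abs_logDetRatio h₁ h₂ (abs_pos.2 hne)).of_isClosed_subset
      isClosed_connectedComponent fun z hz => (congrArg abs (hconst z hz)).ge
  have hopen : IsOpen (connectedComponent x) := isOpen_connectedComponent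
  obtain ⟨p, hp, hpmax⟩ := hK.exists_isMaxOn ⟨x, mem_connectedComponent⟩ hu.continuous.continuousOn
  obtain ⟨q, hq, hqmin⟩ := hK.exists_isMinOn ⟨x, mem_connectedComponent⟩ hu.continuous.continuousOn
  have hle := logDetRatio_nonpos_of_isLocalMax h₁.kaehler h₂.kaehler
    (contDiffOn_comp_extChartAt_symm hu p) (fun y hy v => hη.re_iddbar p hy v)
    (hpmax.isLocalMax (hopen.mem_nhds hp))
  have hge := logDetRatio_nonpos_of_isLocalMax h₂.kaehler h₁.kaehler (u := fun z => -u z)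
    (contDiffOn_comp_extChartAt_symm hu q).neg (fun y hy v => hη.re_iddbar_neg hu q hy v)
    (hqmin.isLocalMin (hopen.mem_nhds hq)).neg
  rw [logDetRatio_swap, hconst q hq] at hge
  rw [hconst p hp] at hle
  exact hne (by linarith)

theorem eventually_eq_const_of_ricciFlat (h₁ : IsRicciFlatConicalKaehler B gS η₁)
    (h₂ : IsRicciFlatConicalKaehler B gS η₂) (hu : ContMDiff 𝓘(ℝ, Cn n) 𝓘(ℝ, ℝ) 2 u)
    (hη : EqAddIddbar η₂ η₁ u) {δ : ℝ} (hδ : 0 < δ) {k : ℕ}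
    (hdecay : weightedCkNorm B gS δ k u < ⊤) (x : X) : ∀ᶠ z in 𝓝 x, u z = u x := by
  have : LocallyConnectedSpace X := ChartedSpace.locallyConnectedSpace (Cn n) X
  have hdet := logDetRatio_eq_zero h₁ h₂ hu hη
  filter_upwards [isOpen_connectedComponent.mem_nhds (mem_connectedComponent (x := x))] with z hz
  refine eq_of_mem_connectedComponent hu.continuous (fun ε hε => B.isCompact_le_abs hu.continuous
    (exists_abs_lt_of_weightedCkNorm_lt_top gS hδ hdecay hε)) (fun p hp => ?_) (fun p hp => ?_) hz
  · exact eventually_eq_of_isLocalMax_of_logDetRatio_eq_zero h₁.kaehler h₂.kaehler hdet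
      (contDiffOn_comp_extChartAt_symm hu p) (fun y hy v => hη.re_iddbar p hy v) hp
  · have := eventually_eq_of_isLocalMax_of_logDetRatio_eq_zero h₂.kaehler h₁.kaehler
      (fun y => by rw [logDetRatio_swap, hdet, neg_zero]) (u := fun z => -u z)
      (contDiffOn_comp_extChartAt_symm hu p).neg (fun y hy v => hη.re_iddbar_neg hu p hy v) hp.neg
    filter_upwards [this] with w hw
    exact neg_injective hw

theorem EqAddIddbar.eq_of_eventually_eq_const (hη : EqAddIddbar η₂ η₁ u)
    (hu : ∀ x, ∀ᶠ z in 𝓝 x, u z = u x) : η₂ = η₁ := by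
  funext x
  have hy := mem_extChartAt_target (I := 𝓘(ℝ, Cn n)) x
  have hi : iddbar (fun z => u ((extChartAt 𝓘(ℝ, Cn n) x).symm z)) (extChartAt 𝓘(ℝ, Cn n) x x)
      = 0 := by
    have hc := continuousAt_extChartAt_symm (I := 𝓘(ℝ, Cn n)) x
    rw [ContinuousAt, extChartAt_to_inv] at hc
    rw [iddbar_congr (hc.eventually (hu x)), iddbar_const]
  have hzero (v : Fin 2 → Cn n) : (0 : Cn n [⋀^Fin 2]→L[ℝ] ℂ) v = 0 := rfl
  have key : η₂ ((extChartAt 𝓘(ℝ, Cn n) x).symm (extChartAt 𝓘(ℝ, Cn n) x x)) =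
      η₁ ((extChartAt 𝓘(ℝ, Cn n) x).symm (extChartAt 𝓘(ℝ, Cn n) x x)) := by
    ext w
    choose v hv using fun j => (chartFrame_bijective_of_complex hy).2 (w j)
    have h := hη x _ hy v
    rw [hi, hzero, add_zero, Complex.ofReal_inj] at h
    have hw : w = fun j => chartFrame 𝓘(ℝ, Cn n) x (extChartAt 𝓘(ℝ, Cn n) x x) (v j) :=
      (funext hv).symm
    rw [hw]
    exact h
  rwa [extChartAt_to_inv] at key

end Uniqueness

end ConicalKaehler

end

theorem theorem1p7 (n : ℕ) (hn : 1 ≤ n)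
    (X : Type*) [TopologicalSpace X] [T2Space X]
    [ChartedSpace (ConicalKaehler.Cn n) X] [IsManifold 𝓘(ℂ, ConicalKaehler.Cn n) ∞ X]
    (S : Type*) [TopologicalSpace S] [T2Space S] [CompactSpace S]
    [ChartedSpace (ConicalKaehler.LinkModel n) S]
    [IsManifold 𝓘(ℝ, ConicalKaehler.LinkModel n) ∞ S]
    (gS : Bundle.ContMDiffRiemannianMetric 𝓘(ℝ, ConicalKaehler.LinkModel n) ∞
      (ConicalKaehler.LinkModel n)
      (TangentSpace 𝓘(ℝ, ConicalKaehler.LinkModel n) : S → Type _))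
    (B : ConicalKaehler.CylindricalBoundary n X S)
    (ω₁ ω₂ : ConicalKaehler.TwoForm n X)
    (h₁ : ConicalKaehler.IsRicciFlatConicalKaehler B gS ω₁)
    (h₂ : ConicalKaehler.IsRicciFlatConicalKaehler B gS ω₂)
    (k : ℕ) (δ : ℝ) (hδ : 0 < δ) (u : X → ℝ)
    (hu : ContMDiff 𝓘(ℝ, ConicalKaehler.Cn n) 𝓘(ℝ, ℝ) ((max 2 k : ℕ) : WithTop ℕ∞) u)
    (hdecay : ConicalKaehler.weightedCkNorm B gS δ k u < ⊤)
    (hω : ConicalKaehler.EqAddIddbar ω₂ ω₁ u) :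
    ω₂ = ω₁ := by
  have hu' : ContMDiff 𝓘(ℝ, ConicalKaehler.Cn n) 𝓘(ℝ, ℝ) 2 u :=
    hu.of_le (by exact_mod_cast le_max_left 2 k)
  exact hω.eq_of_eventually_eq_const
    (ConicalKaehler.eventually_eq_const_of_ricciFlat h₁ h₂ hu' hω hδ hdecay)
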